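/- **Setting.** Let $V$ be a real Hilbert space (a complex one is regarded as a real one), $\mathcal L$ a bounded skew-adjoint operator on $V$, $\varepsilon>0$, and $\mathcal N:V\to V$. Put $N(\tau,w)=e^{\tau\mathcal L}\mathcal N(e^{-\tau\mathcal L}w)$. The modulation equation is $w'(t)=N(t/\varepsilon,w(t))$. For a kernel $\rho\ge 0$ on $[-\tfrac12,\tfrac12]$ with $\int\rho=1$ and windows $\eta_l>0$ (measured in the fast time $t/\varepsilon$), the averaged equation of level $l$ is $$\bar w'(t)=\frac1{\eta_l}\int_{-\eta_l/2}^{\eta_l/2}\rho\Big(\frac s{\eta_l}\Big)N\Big(\frac t\varepsilon+s,\bar w(t)\Big)\,ds .$$ Let $D\subset V$ be open, convex and invariant under all $e^{\tau\mathcal L}$, let $\mathcal N$ be $C^2$ on $D$ with $\|\mathcal N\|,\|D\mathcal N\|,\|D^2\mathcal N\|\le M$ on $D$, and let $S\subset V$ be a set of states such that from every $x\in S$ and every start time $t\in[0,T]$ both equations are solvable in $D$ up to time $T$ (for instance $S=D=V$). Let $E(t,h,x)$ and $\bar E^l(t,h,x)$ be the values at time $t+h$ of the solutions of the modulation equation and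 of the averaged equation of level $l$ that start from $x$ at time $t$. **Method.** Levels are $0,\dots,L-1$ (fine to coarse), with time-steps $\Delta T_l=N^l\Delta T_0$, $\Delta T_0>0$, coarsening factor $N\ge1$, and $N\Delta T_{L-1}=T$. On level $0$ a one-step scheme $G^0$ for the modulation equation is given, on level $l\ge1$ a one-step scheme $\bar G^l$ for the averaged equation of level $l$. Let $P^0$ be $N$ serial steps of $G^0$. For $l\ge1$, an interval $[t,t+N\Delta T_l]$, $T_n=t+n\Delta T_l$ and initial value $x$, define $U_{0}^{k}=x$, $$U_{n+1}^{0}=\bar G^l(T_n,U_n^0),\qquad U_{n+1}^{k+1}=\bar G^l(T_n,U_n^{k+1})+P^{l-1}(T_n,U_n^k)-\bar G^l(T_n,U_n^k),$$ and let $P^l(t,x)=U_N^{k_l}$, where $k_l$ is the number of iterations on level $l$. The error on level $l$ is $e_{n,l}^{k_l}=\|E(t,n\Delta T_l,x)-U_n^{k_l}\|$. **Assumptions on the schemes** (for states in $S$ and all steps inside $[0,T]$). For $l=1,\dots,L-1$: 1. $\bar E^l(t,\Delta T_l,x)-\bar G^l(t,x)$ has norm at most $\bar C_1^l\Delta T_l^{p_c+1}$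 and an expansion $\bar c^{\,l}_{p_c+1}(t,x)\Delta T_l^{p_c+1}+\bar c^{\,l}_{p_c+2}(t,x)\Delta T_l^{p_c+2}+\cdots$ whose coefficients $\bar c^{\,l}_{p_c+1+j}$ are Lipschitz in $x$ with constants $\lambda_j$, $\sum_{j\ge 0}\lambda_j\Delta T_l^j\le\bar C_1^l$; 2. $\|\bar G^l(t,x)-\bar G^l(t,y)\|\le(1+C_{2,l}\Delta T_l)\|x-y\|$, $C_{2,l}\ge0$; 3. $\bar C_1^l\le C_1K_l$ with $K_l=\max_{\omega_0\le\omega}\{|\varepsilon/\omega|\,\kappa(\varepsilon,\eta_l,\omega)\}$ (a supremum, assumed finite), where $\omega_0>0$ and $\kappa\ge0$ is the function that describes the dependence of the truncation error constants on $\varepsilon$ and $\eta_l$. Moreover $\|E(t,\Delta T_0,x)-G^0(t,x)\|\le c\,\Delta T_0^{p_0+1}$, $c\ge 0$. **Theorem.** There is a constant $C>0$, depending only on $M$, $T$, $C_1$ (and $V$), such that in every such situation the following holds. Put $\mathcal M_{1,l}=E-\bar E^l$ and $\mathcal M_{0,l}=\bar E^l-\bar G^l$ (over one step $\Delta T_l$),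 let $\|\tilde{\mathcal M}_1\|$ be the supremum of $\|\mathcal M_{1,l}(t,x)\|/(\eta_l\varepsilon)$ and $\|\tilde{\mathcal M}_0\|$ that of $\|\mathcal M_{0,l}(t,x)\|/(\Delta T_l^{p_c+1}K_l)$ over $1\le l\le L-1$, $x\in S$ and admissible $t$ (with $0/0=0$), and $$\bar\alpha_l=C\eta_l\varepsilon+C\Delta T_l^{p_c+1}K_l,\qquad \beta_l=1+C_{2,l}\Delta T_l,\qquad \bar\gamma_l=C\eta_l\varepsilon\|\tilde{\mathcal M}_1\|+C\Delta T_l^{p_c+1}K_l\|\tilde{\mathcal M}_0\| .$$ Then $$\|\mathcal M_{1,l}(t,x)\|\le C\eta_l\varepsilon,\qquad \|\mathcal M_{1,l}(t,x)-\mathcal M_{1,l}(t,y)\|\le C\eta_l\varepsilon\|x-y\|\qquad(x,y\in S),$$ and there are $\bar\alpha_{0N,l}\in[0,\bar\alpha_l]$ with $(1+\bar\alpha_l)^N-1=N\bar\alpha_l(1+\bar\alpha_{0N,l})^{N-1}$ such that, for every $1\le l\le L-1$, every $t\ge0$ with $t+N\Delta T_l\le T$, every $x$ for which all exact and numerical states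 occurring at the grid points in the run of the method from $(t,x)$, on level $l$ and on the finer levels, lie in $S$, and every $0\le n\le N$, $$e_{n,l}^{k_l}\le\sum_{\bar l=1}^{l}\bar E_{\bar l}\prod_{j=\bar l+1}^{l}A_j+\delta_0\prod_{\bar l=1}^{l}A_{\bar l},$$ where $$\bar E_{\bar l}=\binom{n_{\bar l}}{k_{\bar l}+1}\bar\gamma_{\bar l}\,\bar\alpha_{\bar l}^{\,k_{\bar l}}\beta_{\bar l}^{\,N-k_{\bar l}-1},\quad n_l=n,\ n_{\bar l}=N\text{ for }\bar l<l,\qquad A_j=N\beta_j^{N-1}(1+\bar\alpha_{0N,j})^{N-1},\qquad \delta_0=C\,c\,\Delta T_1\Delta T_0^{p_0}$$ (and $\bar E_{\bar l}=0$ if $k_{\bar l}\ge n_{\bar l}$). -/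

import Mathlib

noncomputable section

namespace MLParareal

open Set MeasureTheory

/-! ### The modulation equation and its averages -/

section Equations

variable {V : Type*} [NormedAddCommGroup V] [InnerProductSpace ℝ V] [CompleteSpace V]

/-- The modulated nonlinearity `exp(τ ℒ) 𝒩 (exp(-τ ℒ) w)` at the fast time `τ`. -/
def modulated (Lop : V →L[ℝ] V) (Nl : V → V) (τ : ℝ) (w : V) : V :=
  NormedSpace.exp (τ • Lop) (Nl (NormedSpace.exp (-(τ • Lop)) w))

/-- Right-hand side of the modulation equation `w' = exp(tℒ/ε) 𝒩 (exp(-tℒ/ε) w)`. -/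
def modulationRHS (Lop : V →L[ℝ] V) (Nl : V → V) (ε : ℝ) (t : ℝ) (w : V) : V :=
  modulated Lop Nl (t / ε) w

/-- Right-hand side of the averaged equation with kernel `ρ` and window `η`,
`w' = (1/η) ∫_{-η/2}^{η/2} ρ(s/η) exp((t/ε+s)ℒ) 𝒩 (exp(-(t/ε+s)ℒ) w) ds`.
The window is measured in the fast time `t/ε`. -/
def averagedRHS (Lop : V →L[ℝ] V) (Nl : V → V) (ε : ℝ) (ρ : ℝ → ℝ) (η : ℝ)
    (t : ℝ) (w : V) : V :=
  (1 / η) • ∫ s in (-(η / 2))..(η / 2), ρ (s / η) • modulated Lop Nl (t / ε + s) w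

/-- A normalized nonnegative averaging kernel on `[-1/2, 1/2]`. -/
structure IsKernel (ρ : ℝ → ℝ) : Prop where
  nonneg : ∀ s ∈ Icc (-(1 / 2) : ℝ) (1 / 2), 0 ≤ ρ s
  integrable : IntervalIntegrable ρ volume (-(1 / 2)) (1 / 2)
  integral_eq_one : ∫ s in (-(1 / 2) : ℝ)..(1 / 2), ρ s = 1

/-- `w` solves `w' = f(s, w)` on `[t, b]` with `w t = x` and stays in the region `D`. -/
def IsSolution (f : ℝ → V → V) (D : Set V) (t b : ℝ) (x : V) (w : ℝ → V) : Prop :=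
  w t = x ∧ ∀ s ∈ Icc t b, w s ∈ D ∧ HasDerivWithinAt w (f s (w s)) (Icc t b) s

open Classical in
/-- The exact propagator of `w' = f(s, w)`: the value at time `t + h` of the solution in `D`
on `[t, b]` that starts at time `t` in `x` (and `x` if there is no such solution). -/
def exactProp (f : ℝ → V → V) (D : Set V) (b t h : ℝ) (x : V) : V :=
  if H : ∃ w, IsSolution f D t b x w then H.choose (t + h) else x

end Equations

/-! ### The algorithm -/

section Algorithm

variable {V : Type*} [NormedAddCommGroup V]

/-- `n` serial steps of size `h` with the one-step method `g`, from `x` at time `t`. -/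
def serialSteps (g : ℝ → V → V) (h t : ℝ) (x : V) : ℕ → V
  | 0 => x
  | n + 1 => g (t + n * h) (serialSteps g h t x n)

/-- The Parareal iterates `U_n^k` (`k` iterations, `n` steps of size `h`, started from `x` at
time `t`) with coarse propagator `G` and fine propagator `F`. -/
def iterate (G F : ℝ → V → V) (h t : ℝ) (x : V) : ℕ → ℕ → V
  | _, 0 => x
  | 0, n + 1 => G (t + n * h) (iterate G F h t x 0 n)
  | k + 1, n + 1 =>
      G (t + n * h) (iterate G F h t x (k + 1) n)
        + F (t + n * h) (iterate G F h t x k n)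
        - G (t + n * h) (iterate G F h t x k n)

end Algorithm

/-- The data of a multi-level Parareal method with averaging. -/
structure Data (V : Type*) [NormedAddCommGroup V] [InnerProductSpace ℝ V] where
  /-- the linear operator `ℒ` -/
  Lop : V →L[ℝ] V
  /-- the nonlinearity `𝒩` -/
  Nl : V → V
  /-- the scale separation parameter -/
  ε : ℝ
  /-- the averaging kernel -/
  ρ : ℝ → ℝ
  /-- the averaging window on each level -/
  η : ℕ → ℝ
  /-- the end of the time interval `[0, T]` -/
  T : ℝ
  /-- a region of the state space in which exact solutions evolve -/
  D : Set V
  /-- the set of states at which the propagators are compared -/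
  S : Set V
  /-- the number of levels; they are numbered `0, …, L - 1` from fine to coarse -/
  L : ℕ
  /-- the coarsening factor -/
  N : ℕ
  /-- the time-step on level `0` -/
  dt : ℝ
  /-- the number of Parareal iterations on each level -/
  k : ℕ → ℕ
  /-- one step of the numerical scheme on each level: `G l t x` starts from `x` at time `t` and
  advances by the time-step of level `l` -/
  G : ℕ → ℝ → V → V
  /-- the order of the schemes on the levels `1, …, L - 1` -/
  p : ℕ
  /-- the order of the scheme on level `0` -/
  p₀ : ℕ
  /-- the truncation error constant of level `0` -/
  c : ℝ
  /-- the truncation error constants of the levels `1, …, L - 1` -/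
  Cbar : ℕ → ℝ
  /-- the stability constants of the levels `1, …, L - 1` -/
  C₂ : ℕ → ℝ
  /-- the least frequency -/
  ω₀ : ℝ
  /-- the function `κ(ε, η, ω)` -/
  κ : ℝ → ℝ → ℝ → ℝ

namespace Data

variable {V : Type*} [NormedAddCommGroup V] [InnerProductSpace ℝ V]

/-- The time-step `ΔT_l = N^l ΔT_0`. -/
def step (d : Data V) (l : ℕ) : ℝ := (d.N : ℝ) ^ l * d.dt

/-- The propagators `P^l`, advancing by `N ΔT_l = ΔT_{l+1}`: on level `0`, `N` serial steps of the
basic scheme; on level `l + 1`, Parareal with coarse propagator `G^{l+1}`, fine propagator `P^l`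
and `k_{l+1}` iterations. -/
def P (d : Data V) : ℕ → ℝ → V → V
  | 0 => fun t x => serialSteps (d.G 0) (d.step 0) t x d.N
  | l + 1 => fun t x =>
      iterate (d.G (l + 1)) (P d l) (d.step (l + 1)) t x (d.k (l + 1)) d.N

/-- The iterates `U_n^j` of level `l ≥ 1` on the interval `[t, t + N ΔT_l]`, started from `x`. -/
def U (d : Data V) (l : ℕ) (t : ℝ) (x : V) (j n : ℕ) : V :=
  iterate (d.G l) (d.P (l - 1)) (d.step l) t x j n

/-- `max_{ω ≥ ω₀} |ε/ω| κ(ε, η_l, ω)`. -/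
def K (d : Data V) (l : ℕ) : ℝ :=
  sSup ((fun ω => |d.ε / ω| * d.κ d.ε (d.η l) ω) '' Ici d.ω₀)

variable [CompleteSpace V]

/-- The exact propagator `E` of the modulation equation. -/
def E (d : Data V) (t h : ℝ) (x : V) : V :=
  exactProp (modulationRHS d.Lop d.Nl d.ε) d.D d.T t h x

/-- The exact propagator `Ē^l` of the averaged equation of level `l`. -/
def Ebar (d : Data V) (l : ℕ) (t h : ℝ) (x : V) : V :=
  exactProp (averagedRHS d.Lop d.Nl d.ε d.ρ (d.η l)) d.D d.T t h x

/-- The averaging error `ℳ_{1,l} = E - Ē^l` over one step of level `l`. -/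
def M1 (d : Data V) (l : ℕ) (t : ℝ) (x : V) : V :=
  d.E t (d.step l) x - d.Ebar l t (d.step l) x

/-- The truncation error `ℳ_{0,l} = Ē^l - Ḡ^l` over one step of level `l`. -/
def M0 (d : Data V) (l : ℕ) (t : ℝ) (x : V) : V :=
  d.Ebar l t (d.step l) x - d.G l t x

/-- The supremum, over the levels, start times and states, of `‖ℳ_{1,l}‖ / (ε η_l)`. -/
def normM1 (d : Data V) : ℝ :=
  sSup {r | ∃ l t x, 1 ≤ l ∧ l < d.L ∧ 0 ≤ t ∧ t + d.step l ≤ d.T ∧ x ∈ d.S ∧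
    r = ‖d.M1 l t x‖ / (d.η l * d.ε)}

/-- The supremum, over the levels, start times and states, of
`‖ℳ_{0,l}‖ / (ΔT_l^{p+1} max_ω |ε/ω| κ)`. -/
def normM0 (d : Data V) : ℝ :=
  sSup {r | ∃ l t x, 1 ≤ l ∧ l < d.L ∧ 0 ≤ t ∧ t + d.step l ≤ d.T ∧ x ∈ d.S ∧
    r = ‖d.M0 l t x‖ / (d.step l ^ (d.p + 1) * d.K l)}

/-- The truncation error of level `l`: it is at most `Cbar_l ΔT_l^{p+1}`, and it has an expansion
`c_{p+1}(x) ΔT_l^{p+1} + c_{p+2}(x) ΔT_l^{p+2} + …` whose coefficients are Lipschitz continuous in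
the state, with Lipschitz constants `lam_j` such that `∑_j lam_j ΔT_l^j ≤ Cbar_l`. -/
def TruncationError (d : Data V) (l : ℕ) : Prop :=
  (∀ t, 0 ≤ t → t + d.step l ≤ d.T → ∀ x ∈ d.S,
      ‖d.M0 l t x‖ ≤ d.Cbar l * d.step l ^ (d.p + 1)) ∧
  ∃ (coef : ℕ → ℝ → V → V) (lam : ℕ → ℝ),
    Summable (fun j => lam j * d.step l ^ j) ∧ ∑' j, lam j * d.step l ^ j ≤ d.Cbar l ∧
    ∀ t, 0 ≤ t → t + d.step l ≤ d.T →
      (∀ j, ∀ x ∈ d.S, ∀ y ∈ d.S, ‖coef j t x - coef j t y‖ ≤ lam j * ‖x - y‖) ∧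
      ∀ x ∈ d.S, HasSum (fun j => d.step l ^ (d.p + 1 + j) • coef j t x) (d.M0 l t x)

/-- All exact and numerical states that occur at the grid points when the method of level `l` is
run from `x` at time `t` (on this level and, recursively, on the finer ones) lie in `S`. -/
def RunIn (d : Data V) : ℕ → ℝ → V → Prop
  | 0 => fun t x => ∀ n < d.N, serialSteps (d.G 0) (d.step 0) t x n ∈ d.S
  | l + 1 => fun t x => ∀ n < d.N,
      d.E t (n * d.step (l + 1)) x ∈ d.S ∧
      (∀ j ≤ d.k (l + 1), d.U (l + 1) t x j n ∈ d.S) ∧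
      ∀ j < d.k (l + 1), RunIn d l (t + n * d.step (l + 1)) (d.U (l + 1) t x j n)

/-- The standing assumptions. `M` bounds the nonlinearity and its derivatives on the region `D`;
`C₁` is the factor with which `max_ω |ε/ω| κ(ε, η_l, ω)` controls the truncation error constants
of the schemes for the averaged equations. -/
structure Assumptions (d : Data V) (M C₁ : ℝ) : Prop where
  skew : ContinuousLinearMap.adjoint d.Lop = -d.Lop
  ε_pos : 0 < d.ε
  kernel : IsKernel d.ρ
  η_pos : ∀ l, 1 ≤ l → l < d.L → 0 < d.η l
  -- the region and the nonlinearity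
  D_open : IsOpen d.D
  D_convex : Convex ℝ d.D
  D_invariant : ∀ τ : ℝ, ∀ v ∈ d.D, NormedSpace.exp (τ • d.Lop) v ∈ d.D
  Nl_smooth : ContDiffOn ℝ 2 d.Nl d.D
  Nl_bound : ∀ v ∈ d.D, ‖d.Nl v‖ ≤ M
  Nl_bound' : ∀ v ∈ d.D, ‖fderiv ℝ d.Nl v‖ ≤ M
  Nl_bound'' : ∀ v ∈ d.D, ‖fderiv ℝ (fderiv ℝ d.Nl) v‖ ≤ M
  -- the exact and the averaged equations are solvable in `D` up to time `T` from states in `S`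
  solvable : ∀ t, 0 ≤ t → t ≤ d.T → ∀ x ∈ d.S,
    ∃ w, IsSolution (modulationRHS d.Lop d.Nl d.ε) d.D t d.T x w
  solvable_avg : ∀ l, 1 ≤ l → l < d.L → ∀ t, 0 ≤ t → t ≤ d.T → ∀ x ∈ d.S,
    ∃ w, IsSolution (averagedRHS d.Lop d.Nl d.ε d.ρ (d.η l)) d.D t d.T x w
  -- the grids: `N` steps on the coarsest level cover `[0, T]`
  N_pos : 1 ≤ d.N
  dt_pos : 0 < d.dt
  grid : (d.N : ℝ) ^ d.L * d.dt = d.T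
  -- the coarse schemes: truncation error and stability
  truncation : ∀ l, 1 ≤ l → l < d.L → d.TruncationError l
  C₂_nonneg : ∀ l, 1 ≤ l → l < d.L → 0 ≤ d.C₂ l
  stability : ∀ l, 1 ≤ l → l < d.L → ∀ t, 0 ≤ t → t + d.step l ≤ d.T →
    ∀ x ∈ d.S, ∀ y ∈ d.S, ‖d.G l t x - d.G l t y‖ ≤ (1 + d.C₂ l * d.step l) * ‖x - y‖
  -- dependence of the truncation error constants on `ε` and on the windows
  ω₀_pos : 0 < d.ω₀
  κ_nonneg : ∀ l, 1 ≤ l → l < d.L → ∀ ω, d.ω₀ ≤ ω → 0 ≤ d.κ d.ε (d.η l) ω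
  κ_bdd : ∀ l, 1 ≤ l → l < d.L →
    BddAbove ((fun ω => |d.ε / ω| * d.κ d.ε (d.η l) ω) '' Ici d.ω₀)
  Cbar_le : ∀ l, 1 ≤ l → l < d.L → d.Cbar l ≤ C₁ * d.K l
  -- the fine scheme: local truncation error
  c_nonneg : 0 ≤ d.c
  fine : ∀ t, 0 ≤ t → t + d.step 0 ≤ d.T → ∀ x ∈ d.S,
    ‖d.E t (d.step 0) x - d.G 0 t x‖ ≤ d.c * d.step 0 ^ (d.p₀ + 1)

/-! ### The quantities in the error bound -/

/-- `ᾱ_l`. -/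
def alpha (d : Data V) (C : ℝ) (l : ℕ) : ℝ :=
  C * d.η l * d.ε + C * d.step l ^ (d.p + 1) * d.K l

/-- `β_l`. -/
def beta (d : Data V) (l : ℕ) : ℝ := 1 + d.C₂ l * d.step l

/-- `γ̄_l`. -/
def gamma (d : Data V) (C : ℝ) (l : ℕ) : ℝ :=
  C * d.η l * d.ε * d.normM1 + C * d.step l ^ (d.p + 1) * d.K l * d.normM0

/-- `Ē_l`, the error emerging on level `l` after `n` steps. -/
def levelError (d : Data V) (C : ℝ) (l n : ℕ) : ℝ :=
  (n.choose (d.k l + 1) : ℝ) * d.gamma C l * d.alpha C l ^ d.k l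
    * d.beta l ^ (d.N - d.k l - 1)

/-- The amplification factor `A_l`. -/
def amp (d : Data V) (α₀ : ℕ → ℝ) (l : ℕ) : ℝ :=
  d.N * d.beta l ^ (d.N - 1) * (1 + α₀ l) ^ (d.N - 1)

/-- `δ_0`. -/
def delta0 (d : Data V) (C : ℝ) : ℝ := C * d.c * d.step 1 * d.step 0 ^ d.p₀

end Data

end MLParareal

end

/-!
The averaged right-hand side is the average of the modulated one, `f`, over time shifts of size at
most `η ε / 2`. Along a solution `v` of the averaged equation, the difference of the two right-hand
sides is of size `O(1)`, but, up to `O(η ε)`, it is the derivative of a corrector of size `O(η ε)`;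
Gronwall's inequality for `w - v` plus the corrector therefore shows that the exact solution `w`
and `v` differ by `O(η ε)`. Applied to the field that governs pairs `(w₁, a⁻¹ (w₂ - w₁))`, with `a`
tending to the distance of the initial values, the same estimate shows that the averaging error
is Lipschitz with constant `O(η ε)`.

Hence on each level the difference of the exact and the coarse propagator is bounded by `γ` and
Lipschitz with constant `α`, and the errors `e j n` of the Parareal iteration satisfy
`e (j + 1) (n + 1) ≤ α * e j n + β * e (j + 1) n + δ`, where `δ` is the error of the fine
propagator. Pascal's rule solves this recursion with a binomial term for `γ` and a geometric sum
for `δ`. As `δ` is itself the error of the next finer level, the estimate follows by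
induction on the level.
-/

namespace MLParareal

open Set MeasureTheory Function Filter Topology

section Gronwall

variable {E : Type*} [NormedAddCommGroup E] [NormedSpace ℝ E]

lemma norm_le_gronwallBound_of_hasDerivWithinAt_Icc {z z' : ℝ → E} {δ K ε t b : ℝ}
    (hz : ∀ s ∈ Icc t b, HasDerivWithinAt z (z' s) (Icc t b) s) (h₀ : ‖z t‖ ≤ δ)
    (hz' : ∀ s ∈ Icc t b, ‖z' s‖ ≤ K * ‖z s‖ + ε) :
    ∀ s ∈ Icc t b, ‖z s‖ ≤ gronwallBound δ K ε (s - t) := by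
  refine norm_le_gronwallBound_of_norm_deriv_right_le (fun s hs => (hz s hs).continuousWithinAt)
    (fun s hs => ?_) h₀ fun s hs => hz' s (Ico_subset_Icc_self hs)
  refine (hz s (Ico_subset_Icc_self hs)).mono_of_mem_nhdsWithin ?_
  exact mem_nhdsWithin_iff_exists_mem_nhds_inter.2
    ⟨Iio b, Iio_mem_nhds hs.2, fun r hr => ⟨hs.1.trans hr.2, hr.1.le⟩⟩

lemma norm_sub_le_mul_exp_of_isIntegralCurveOn {f : ℝ → E → E} {D : Set E} {K t b : ℝ}
    {w v : ℝ → E} (hf : ∀ s, ∀ x ∈ D, ∀ y ∈ D, ‖f s x - f s y‖ ≤ K * ‖x - y‖)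
    (hw : IsIntegralCurveOn w f (Icc t b)) (hv : IsIntegralCurveOn v f (Icc t b))
    (hwD : MapsTo w (Icc t b) D) (hvD : MapsTo v (Icc t b) D) :
    ∀ s ∈ Icc t b, ‖w s - v s‖ ≤ ‖w t - v t‖ * Real.exp (K * (s - t)) := by
  intro s hs
  simpa only [gronwallBound_ε0, Pi.sub_apply] using
    norm_le_gronwallBound_of_hasDerivWithinAt_Icc (ε := 0)
      (fun r hr => (hw r hr).sub (hv r hr)) le_rfl
      (fun r hr => by simpa using hf r _ (hwD hr) _ (hvD hr)) s hs

lemma mul_gronwallBound (a δ K ε x : ℝ) :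
    gronwallBound (a * δ) K (a * ε) x = a * gronwallBound δ K ε x := by
  by_cases hK : K = 0 <;> simp only [gronwallBound, hK, if_true, if_false] <;> ring

end Gronwall

/-- A time-dependent map `f` on the open convex region `D` that is jointly `C¹`, bounded by `B`, and
whose derivative in the state is bounded by `K`, both uniformly in time. -/
structure IsC1Field {E F : Type*} [NormedAddCommGroup E] [NormedSpace ℝ E]
    [NormedAddCommGroup F] [NormedSpace ℝ F] (f : ℝ → E → F) (D : Set E) (B K : ℝ) : Prop where
  isOpen : IsOpen D
  convex : Convex ℝ D
  contDiffOn : ContDiffOn ℝ 1 (uncurry f) (univ ×ˢ D)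
  norm_le : ∀ s, ∀ x ∈ D, ‖f s x‖ ≤ B
  norm_fderiv_le : ∀ s, ∀ x ∈ D, ‖fderiv ℝ (f s) x‖ ≤ K

namespace IsC1Field

variable {E F : Type*} [NormedAddCommGroup E] [NormedSpace ℝ E] [NormedAddCommGroup F]
  [NormedSpace ℝ F] {f : ℝ → E → F} {D : Set E} {B K : ℝ} {x y : E}

lemma nonneg_bound (h : IsC1Field f D B K) (hx : x ∈ D) : 0 ≤ B :=
  (norm_nonneg _).trans (h.norm_le 0 x hx)

lemma nonneg_fderiv_bound (h : IsC1Field f D B K) (hx : x ∈ D) : 0 ≤ K :=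
  (norm_nonneg _).trans (h.norm_fderiv_le 0 x hx)

lemma univ_prod_mem_nhds (h : IsC1Field f D B K) (s : ℝ) (hx : x ∈ D) :
    univ ×ˢ D ∈ 𝓝 (s, x) :=
  (isOpen_univ.prod h.isOpen).mem_nhds ⟨mem_univ _, hx⟩

lemma hasFDerivAt (h : IsC1Field f D B K) (s : ℝ) (hx : x ∈ D) :
    HasFDerivAt (uncurry f) (fderiv ℝ (uncurry f) (s, x)) (s, x) :=
  ((h.contDiffOn.differentiableOn one_ne_zero).differentiableAt
    (h.univ_prod_mem_nhds s hx)).hasFDerivAt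

lemma hasFDerivAt_state (h : IsC1Field f D B K) (s : ℝ) (hx : x ∈ D) :
    HasFDerivAt (f s) (fderiv ℝ (uncurry f) (s, x) ∘L ContinuousLinearMap.inr ℝ ℝ E) x :=
  (h.hasFDerivAt s hx).comp x (hasFDerivAt_prodMk_right s x)

lemma hasDerivAt_time (h : IsC1Field f D B K) (s : ℝ) (hx : x ∈ D) :
    HasDerivAt (fun r => f r x) (fderiv ℝ (uncurry f) (s, x) (1, 0)) s :=
  (h.hasFDerivAt s hx).comp_hasDerivAt (f := fun r => (r, x)) s
    ((hasDerivAt_id s).prodMk (hasDerivAt_const s x))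

lemma continuousAt_fderiv (h : IsC1Field f D B K) (s : ℝ) (hx : x ∈ D) :
    ContinuousAt (fderiv ℝ (uncurry f)) (s, x) :=
  (h.contDiffOn.continuousOn_fderiv_of_isOpen (isOpen_univ.prod h.isOpen) le_rfl).continuousAt
    (h.univ_prod_mem_nhds s hx)

lemma continuous_time (h : IsC1Field f D B K) (hx : x ∈ D) : Continuous fun s => f s x :=
  continuous_iff_continuousAt.2 fun s => (h.hasDerivAt_time s hx).continuousAt

lemma continuous_fderiv_time (h : IsC1Field f D B K) (hx : x ∈ D) :
    Continuous fun s => fderiv ℝ (uncurry f) (s, x) :=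
  continuous_iff_continuousAt.2 fun s =>
    (h.continuousAt_fderiv s hx).comp (f := fun s => (s, x)) (by fun_prop)

lemma norm_sub_le (h : IsC1Field f D B K) (s : ℝ) (hx : x ∈ D) (hy : y ∈ D) :
    ‖f s x - f s y‖ ≤ K * ‖x - y‖ :=
  h.convex.norm_image_sub_le_of_norm_fderiv_le
    (fun _ hz => (h.hasFDerivAt_state s hz).differentiableAt) (h.norm_fderiv_le s) hy hx

lemma norm_fderiv_uncurry_zero_apply_le (h : IsC1Field f D B K) (s : ℝ) (hx : x ∈ D) (v : E) :
    ‖fderiv ℝ (uncurry f) (s, x) (0, v)‖ ≤ K * ‖v‖ := by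
  have := (fderiv ℝ (f s) x).le_of_opNorm_le (h.norm_fderiv_le s x hx) v
  simpa [(h.hasFDerivAt_state s hx).fderiv] using this

end IsC1Field

lemma exists_eventually_forall_norm_le_of_isCompact {X Y F : Type*} [TopologicalSpace X]
    [TopologicalSpace Y] [SeminormedAddGroup F] {g : X × Y → F} {S : Set Y} {x : X}
    (hS : IsCompact S) (hg : ∀ y ∈ S, ContinuousAt g (x, y)) :
    ∃ C, ∀ᶠ z in 𝓝 x, ∀ y ∈ S, ‖g (z, y)‖ ≤ C := by
  have hgx : ContinuousOn (fun y => ‖g (x, y)‖) S := fun y hy =>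
    ((hg y hy).comp (f := fun y => (x, y)) (by fun_prop)).norm.continuousWithinAt
  obtain ⟨C, hC⟩ := hS.bddAbove_image hgx
  refine ⟨C + 1, hS.eventually_forall_of_forall_eventually fun y hy => ?_⟩
  have hlt : ‖g (x, y)‖ < C + 1 := (hC (mem_image_of_mem _ hy)).trans_lt (lt_add_one C)
  exact ((hg y hy).norm.eventually_lt continuousAt_const hlt).mono fun _ => le_of_lt

section Averaging

variable {E F G : Type*} [NormedAddCommGroup E] [NormedSpace ℝ E] [NormedAddCommGroup F]
  [NormedSpace ℝ F] [NormedAddCommGroup G] [NormedSpace ℝ G]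

/-- The average of the time-dependent map `f` over random time shifts with distribution `ν`. -/
noncomputable def shiftAverage (ν : Measure ℝ) (f : ℝ → E → F) (s : ℝ) (x : E) : F :=
  ∫ r, f (s + r) x ∂ν

/-- The distribution of `(r, θ)` for a time shift `r` with distribution `ν` and an independent
uniform `θ ∈ [0, 1]`. -/
noncomputable def shiftMeasure (ν : Measure ℝ) : Measure (ℝ × ℝ) :=
  ν.prod (volume.restrict (Icc 0 1))

/-- The corrector `∫∫₀¹ r g(s + θ r) dθ dν(r)`. It is of the size of the time shifts, and for
`g = u'` it equals the difference of the average of `u` over the time shifts and `u s`. -/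
noncomputable def corrector (ν : Measure ℝ) (g : ℝ → G) (s : ℝ) : G :=
  ∫ q, q.1 • g (s + q.2 * q.1) ∂(shiftMeasure ν)

variable {ν : Measure ℝ} {R : ℝ}

lemma ae_shiftMeasure_abs_le (hν : ∀ᵐ r ∂ν, |r| ≤ R) :
    ∀ᵐ q ∂(shiftMeasure ν), |q.1| ≤ R ∧ q.2 * q.1 ∈ Icc (-R) R := by
  have hr : ∀ᵐ q ∂(shiftMeasure ν), |q.1| ≤ R := Measure.quasiMeasurePreserving_fst.ae hν
  have hθ : ∀ᵐ q ∂(shiftMeasure ν), q.2 ∈ Icc (0 : ℝ) 1 :=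
    Measure.quasiMeasurePreserving_snd.ae (ae_restrict_mem measurableSet_Icc)
  filter_upwards [hr, hθ] with q hr hθ
  refine ⟨hr, abs_le.1 ?_⟩
  rw [abs_mul, abs_of_nonneg hθ.1]
  exact (mul_le_of_le_one_left (abs_nonneg _) hθ.2).trans hr

variable [IsProbabilityMeasure ν]

instance : IsProbabilityMeasure (shiftMeasure ν) := by
  have : IsProbabilityMeasure (volume.restrict (Icc (0 : ℝ) 1)) := ⟨by simp⟩
  unfold shiftMeasure
  infer_instance

lemma nonneg_of_ae_abs_le (hν : ∀ᵐ r ∂ν, |r| ≤ R) : 0 ≤ R :=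
  let ⟨_, hr⟩ := hν.exists
  (abs_nonneg _).trans hr

lemma ae_norm_corrector_integrand_le {g : ℝ → G} {s B : ℝ} (hν : ∀ᵐ r ∂ν, |r| ≤ R)
    (hB : ∀ r ∈ Icc (-R) R, ‖g (s + r)‖ ≤ B) :
    ∀ᵐ q ∂(shiftMeasure ν), ‖q.1 • g (s + q.2 * q.1)‖ ≤ R * B := by
  filter_upwards [ae_shiftMeasure_abs_le hν] with q hq
  rw [norm_smul]
  exact mul_le_mul hq.1 (hB _ hq.2) (norm_nonneg _) (nonneg_of_ae_abs_le hν)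

lemma norm_corrector_le {g : ℝ → G} {B : ℝ} (hν : ∀ᵐ r ∂ν, |r| ≤ R) (hB : ∀ r, ‖g r‖ ≤ B)
    (s : ℝ) : ‖corrector ν g s‖ ≤ R * B := by
  simpa only [corrector, probReal_univ, mul_one] using
    norm_integral_le_of_norm_le_const (ae_norm_corrector_integrand_le (s := s) hν fun r _ => hB _)

lemma integrable_corrector_integrand {g : ℝ → G} (hν : ∀ᵐ r ∂ν, |r| ≤ R) (hg : Continuous g)
    (s : ℝ) : Integrable (fun q : ℝ × ℝ => q.1 • g (s + q.2 * q.1)) (shiftMeasure ν) := by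
  obtain ⟨B, hB⟩ := (isCompact_Icc (a := -R) (b := R)).exists_bound_of_continuousOn
    (f := fun r => g (s + r)) (by fun_prop)
  exact (integrable_const (R * B)).mono' (by fun_prop) (ae_norm_corrector_integrand_le hν hB)

lemma corrector_eq_integral_sub [CompleteSpace G] {u u' : ℝ → G} (hν : ∀ᵐ r ∂ν, |r| ≤ R)
    (hu : ∀ s, HasDerivAt u (u' s) s) (hu' : Continuous u') (s : ℝ) :
    corrector ν u' s = ∫ r, (u (s + r) - u s) ∂ν := by
  rw [corrector, shiftMeasure, integral_prod _ (integrable_corrector_integrand hν hu' s)]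
  refine integral_congr_ae (ae_of_all _ fun r => ?_)
  have hderiv : ∀ θ : ℝ, HasDerivAt (fun θ => u (s + θ * r)) (r • u' (s + θ * r)) θ := by
    intro θ
    have haff : HasDerivAt (fun θ : ℝ => s + θ * r) r θ := by
      simpa using ((hasDerivAt_id θ).mul_const r).const_add s
    exact (hu _).scomp θ haff
  have hFTC := intervalIntegral.integral_eq_sub_of_hasDerivAt (a := 0) (b := 1)
    (fun θ _ => hderiv θ) (Continuous.intervalIntegrable (by fun_prop) _ _)
  simpa [integral_Icc_eq_integral_Ioc, ← intervalIntegral.integral_of_le] using hFTC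

end Averaging

namespace IsC1Field

variable {E F : Type*} [NormedAddCommGroup E] [NormedSpace ℝ E] [NormedAddCommGroup F]
  [NormedSpace ℝ F] {f : ℝ → E → F} {D : Set E} {B K R : ℝ} {ν : Measure ℝ}
  [IsProbabilityMeasure ν] {x y : E}

lemma integrable_shift (h : IsC1Field f D B K) (s : ℝ) (hx : x ∈ D) :
    Integrable (fun r => f (s + r) x) ν :=
  (integrable_const B).mono'
    ((h.continuous_time hx).comp (continuous_const_add s)).aestronglyMeasurable
    (ae_of_all _ fun _ => h.norm_le _ x hx)

lemma norm_shiftAverage_le (h : IsC1Field f D B K) (s : ℝ) (hx : x ∈ D) :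
    ‖shiftAverage ν f s x‖ ≤ B := by
  simpa only [shiftAverage, probReal_univ, mul_one] using
    norm_integral_le_of_norm_le_const (ae_of_all ν fun r => h.norm_le (s + r) x hx)

lemma norm_shiftAverage_sub_le (h : IsC1Field f D B K) (s : ℝ) (hx : x ∈ D) (hy : y ∈ D) :
    ‖shiftAverage ν f s x - shiftAverage ν f s y‖ ≤ K * ‖x - y‖ := by
  rw [shiftAverage, shiftAverage,
    ← integral_sub (h.integrable_shift s hx) (h.integrable_shift s hy)]
  simpa only [probReal_univ, mul_one] using
    norm_integral_le_of_norm_le_const (ae_of_all ν fun r => h.norm_sub_le (s + r) hx hy)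

lemma exists_eventually_norm_fderiv_le (h : IsC1Field f D B K) (s R : ℝ) (hx : x ∈ D) :
    ∃ C, ∀ᶠ p : ℝ × E in 𝓝 (s, x), p.2 ∈ D ∧
      ∀ r ∈ Icc (-R) R, ‖fderiv ℝ (uncurry f) (p.1 + r, p.2)‖ ≤ C := by
  obtain ⟨C, hC⟩ := exists_eventually_forall_norm_le_of_isCompact (x := (s, x))
    (g := fun z : (ℝ × E) × ℝ => fderiv ℝ (uncurry f) (z.1.1 + z.2, z.1.2))
    (isCompact_Icc (a := -R) (b := R)) fun r _ =>
      (h.continuousAt_fderiv (s + r) hx).comp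
        (f := fun z : (ℝ × E) × ℝ => (z.1.1 + z.2, z.1.2)) (by fun_prop)
  exact ⟨C, (continuousAt_snd.eventually_mem (h.isOpen.mem_nhds hx)).and hC⟩

lemma hasFDerivAt_corrector (h : IsC1Field f D B K) (hν : ∀ᵐ r ∂ν, |r| ≤ R) (s : ℝ)
    (hx : x ∈ D) :
    HasFDerivAt (fun p : ℝ × E => corrector ν (fun r => f r p.2) p.1)
      (corrector ν (fun r => fderiv ℝ (uncurry f) (r, x)) s) (s, x) := by
  obtain ⟨C, hC⟩ := h.exists_eventually_norm_fderiv_le s R hx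
  refine hasFDerivAt_integral_of_dominated_of_fderiv_le (bound := fun _ => R * C)
    (F' := fun p q => q.1 • fderiv ℝ (uncurry f) (p.1 + q.2 * q.1, p.2)) hC
    (hC.mono fun p hp =>
      (integrable_corrector_integrand hν (h.continuous_time hp.1) p.1).aestronglyMeasurable)
    (integrable_corrector_integrand hν (h.continuous_time hx) s)
    (integrable_corrector_integrand hν (h.continuous_fderiv_time hx) s).aestronglyMeasurable
    ?_ (integrable_const _) (ae_of_all _ fun q p hp => ?_)
  · filter_upwards [ae_shiftMeasure_abs_le hν] with q hq p hp
    rw [norm_smul]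
    exact mul_le_mul hq.1 (hp.2 _ hq.2) (norm_nonneg _) (nonneg_of_ae_abs_le hν)
  · have hshift : HasFDerivAt (fun p : ℝ × E => (p.1 + q.2 * q.1, p.2))
        (ContinuousLinearMap.id ℝ (ℝ × E)) p := by
      rw [← ContinuousLinearMap.fst_prod_snd]
      exact (hasFDerivAt_fst.add_const _).prodMk hasFDerivAt_snd
    exact ((h.hasFDerivAt _ hp.1).comp p hshift).const_smul q.1

lemma corrector_fderiv_apply (h : IsC1Field f D B K) (hν : ∀ᵐ r ∂ν, |r| ≤ R) (s : ℝ)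
    (hx : x ∈ D) (p : ℝ × E) :
    corrector ν (fun r => fderiv ℝ (uncurry f) (r, x)) s p =
      corrector ν (fun r => fderiv ℝ (uncurry f) (r, x) p) s :=
  ContinuousLinearMap.integral_apply
    (integrable_corrector_integrand hν (h.continuous_fderiv_time hx) s) p

lemma hasDerivWithinAt_corrector [CompleteSpace F] (h : IsC1Field f D B K)
    (hν : ∀ᵐ r ∂ν, |r| ≤ R) {v : ℝ → E} {v' : E} {A : Set ℝ} {s : ℝ} (hvD : v s ∈ D)
    (hv : HasDerivWithinAt v v' A s) :
    HasDerivWithinAt (fun r => corrector ν (fun τ => f τ (v r)) r)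
      (shiftAverage ν f s (v s) - f s (v s)
        + corrector ν (fun r => fderiv ℝ (uncurry f) (r, v s) (0, v')) s) A s := by
  have hcurve : HasDerivWithinAt (fun r => (r, v r)) ((1 : ℝ), v') A s :=
    (hasDerivWithinAt_id s A).prodMk hv
  have htime : corrector ν (fun r => fderiv ℝ (uncurry f) (r, v s) (1, 0)) s =
      shiftAverage ν f s (v s) - f s (v s) := by
    rw [corrector_eq_integral_sub hν (fun r => h.hasDerivAt_time r hvD)
        ((h.continuous_fderiv_time hvD).clm_apply continuous_const),
      integral_sub (h.integrable_shift s hvD) (integrable_const _)]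
    simp [shiftAverage]
  have hsplit : ((1 : ℝ), v') = (1, 0) + (0, v') := by simp
  rw [← htime, ← h.corrector_fderiv_apply hν s hvD, ← h.corrector_fderiv_apply hν s hvD,
    ← map_add, ← hsplit]
  exact (h.hasFDerivAt_corrector hν s hvD).comp_hasDerivWithinAt s hcurve

end IsC1Field

section AveragingError

variable {E : Type*} [NormedAddCommGroup E] [NormedSpace ℝ E] {f : ℝ → E → E} {D : Set E}
  {B K R t b T : ℝ} {ν : Measure ℝ} [IsProbabilityMeasure ν] {w v : ℝ → E}

/-- The factor with which time shifts of size `R` perturb solutions on an interval of length `T`,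
for a vector field bounded by `B` with state derivative bounded by `K`. -/
noncomputable def averagingConst (B K T : ℝ) : ℝ := gronwallBound B K (2 * K * B) T + B

lemma averagingConst_mono (hB : 0 ≤ B) (hK : 0 ≤ K) : Monotone (averagingConst B K) :=
  fun _ _ hT => add_le_add_left (gronwallBound_mono hB (by positivity) hK hT) B

lemma averagingConst_nonneg (hB : 0 ≤ B) (hK : 0 ≤ K) (hT : 0 ≤ T) :
    0 ≤ averagingConst B K T := by
  refine le_trans ?_ (averagingConst_mono hB hK hT)
  rw [averagingConst, gronwallBound_x0]
  positivity

namespace IsC1Field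

lemma norm_corrector_le (h : IsC1Field f D B K) (hν : ∀ᵐ r ∂ν, |r| ≤ R) (s : ℝ) {x : E}
    (hx : x ∈ D) : ‖corrector ν (fun r => f r x) s‖ ≤ R * B :=
  MLParareal.norm_corrector_le hν (fun r => h.norm_le r x hx) s

/-- The corrector removes the `O(1)` difference `f - shiftAverage ν f` from the derivative of
`w - v`. -/
lemma hasDerivWithinAt_sub_add_corrector [CompleteSpace E] (h : IsC1Field f D B K)
    (hν : ∀ᵐ r ∂ν, |r| ≤ R) (hw : IsIntegralCurveOn w f (Icc t b))
    (hv : IsIntegralCurveOn v (shiftAverage ν f) (Icc t b)) {s : ℝ} (hs : s ∈ Icc t b)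
    (hvD : v s ∈ D) :
    HasDerivWithinAt (fun r => w r - v r + corrector ν (fun τ => f τ (v r)) r)
      (f s (w s) - f s (v s) + corrector ν
        (fun r => fderiv ℝ (uncurry f) (r, v s) (0, shiftAverage ν f s (v s))) s) (Icc t b) s := by
  convert! ((hw s hs).sub (hv s hs)).add (h.hasDerivWithinAt_corrector hν hvD (hv s hs)) using 1
  abel

theorem norm_sub_le_mul_averagingConst [CompleteSpace E] (h : IsC1Field f D B K)
    (hν : ∀ᵐ r ∂ν, |r| ≤ R) (hw : IsIntegralCurveOn w f (Icc t b))
    (hv : IsIntegralCurveOn v (shiftAverage ν f) (Icc t b)) (hwD : MapsTo w (Icc t b) D)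
    (hvD : MapsTo v (Icc t b) D) (h₀ : w t = v t) {s : ℝ} (hs : s ∈ Icc t b) :
    ‖w s - v s‖ ≤ R * averagingConst B K (s - t) := by
  set c : ℝ → E := fun r => corrector ν (fun τ => f τ (v r)) r
  have ht : t ∈ Icc t b := ⟨le_rfl, hs.1.trans hs.2⟩
  have hK : 0 ≤ K := h.nonneg_fderiv_bound (hvD ht)
  have hc : ∀ r ∈ Icc t b, ‖c r‖ ≤ R * B := fun r hr => h.norm_corrector_le hν r (hvD hr)
  have hwv : ∀ r ∈ Icc t b, ‖w r - v r‖ ≤ ‖w r - v r + c r‖ + R * B := fun r hr =>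
    calc ‖w r - v r‖ = ‖w r - v r + c r - c r‖ := by rw [add_sub_cancel_right]
      _ ≤ ‖w r - v r + c r‖ + R * B := (_root_.norm_sub_le _ _).trans (by gcongr; exact hc r hr)
  have hderiv : ∀ r ∈ Icc t b, ‖f r (w r) - f r (v r) + corrector ν
      (fun τ => fderiv ℝ (uncurry f) (τ, v r) (0, shiftAverage ν f r (v r))) r‖ ≤
      K * ‖w r - v r + c r‖ + R * (2 * K * B) := fun r hr =>
    calc _ ≤ K * ‖w r - v r‖ + R * (K * B) := by
          refine norm_add_le_of_le (h.norm_sub_le r (hwD hr) (hvD hr))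
            (MLParareal.norm_corrector_le hν (fun τ => ?_) r)
          exact (h.norm_fderiv_uncurry_zero_apply_le τ (hvD hr) _).trans
            (mul_le_mul_of_nonneg_left (h.norm_shiftAverage_le r (hvD hr)) hK)
      _ ≤ K * (‖w r - v r + c r‖ + R * B) + R * (K * B) := by gcongr; exact hwv r hr
      _ = K * ‖w r - v r + c r‖ + R * (2 * K * B) := by ring
  have hgronwall := norm_le_gronwallBound_of_hasDerivWithinAt_Icc
    (fun r hr => h.hasDerivWithinAt_sub_add_corrector hν hw hv hr (hvD hr))
    (by simpa [h₀] using hc t ht) hderiv s hs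
  rw [mul_gronwallBound] at hgronwall
  calc ‖w s - v s‖ ≤ R * gronwallBound B K (2 * K * B) (s - t) + R * B :=
        (hwv s hs).trans (by gcongr)
    _ = R * averagingConst B K (s - t) := by rw [averagingConst]; ring

end IsC1Field

end AveragingError

section DifferenceQuotient

variable {E : Type*} [NormedAddCommGroup E] [NormedSpace ℝ E] {f : ℝ → E → E} {D : Set E}
  {B K K' R a r : ℝ}

/-- The vector field whose integral curves are `(w₁, a⁻¹ (w₂ - w₁))` for pairs `w₁`, `w₂` of
integral curves of `f`; bounds for it turn sup norm estimates into Lipschitz estimates. -/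
noncomputable def differenceQuotient (f : ℝ → E → E) (a s : ℝ) (p : E × E) : E × E :=
  (f s p.1, a⁻¹ • (f s (p.1 + a • p.2) - f s p.1))

/-- The states of `differenceQuotient f a` that come from pairs of states in `D` and whose
difference quotient is of norm less than `r`. -/
def differenceQuotientDomain (D : Set E) (a r : ℝ) : Set (E × E) :=
  {p | p.1 ∈ D ∧ p.1 + a • p.2 ∈ D ∧ ‖p.2‖ < r}

lemma isOpen_differenceQuotientDomain (hD : IsOpen D) (a r : ℝ) :
    IsOpen (differenceQuotientDomain D a r) :=
  (hD.preimage continuous_fst).inter ((hD.preimage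
    (f := fun p : E × E => p.1 + a • p.2) (by fun_prop)).inter
    (isOpen_lt continuous_snd.norm continuous_const))

lemma convex_differenceQuotientDomain (hD : Convex ℝ D) (a r : ℝ) :
    Convex ℝ (differenceQuotientDomain D a r) := by
  have hball : {p : E × E | ‖p.2‖ < r} = LinearMap.snd ℝ E E ⁻¹' Metric.ball 0 r := by
    ext
    simp
  refine (hD.linear_preimage (LinearMap.fst ℝ E E)).inter
    ((hD.linear_preimage (LinearMap.fst ℝ E E + a • LinearMap.snd ℝ E E)).inter
      (?_ : Convex ℝ {p : E × E | ‖p.2‖ < r}))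
  rw [hball]
  exact (convex_ball 0 r).linear_preimage _

namespace IsC1Field

lemma norm_differenceQuotient_le (h : IsC1Field f D B K) (ha : 0 < a) (s : ℝ) {p : E × E}
    (hp : p ∈ differenceQuotientDomain D a r) : ‖differenceQuotient f a s p‖ ≤ B + K * r := by
  have hB := h.nonneg_bound hp.1
  have hK := h.nonneg_fderiv_bound hp.1
  have hr : 0 < r := (norm_nonneg _).trans_lt hp.2.2
  refine max_le ((h.norm_le s _ hp.1).trans (le_add_of_nonneg_right (by positivity)))
    (le_trans ?_ (le_add_of_nonneg_left hB))
  calc ‖a⁻¹ • (f s (p.1 + a • p.2) - f s p.1)‖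
      = a⁻¹ * ‖f s (p.1 + a • p.2) - f s p.1‖ := norm_smul_of_nonneg (inv_nonneg.2 ha.le) _
    _ ≤ a⁻¹ * (K * ‖p.1 + a • p.2 - p.1‖) := by gcongr; exact h.norm_sub_le s hp.2.1 hp.1
    _ = K * ‖p.2‖ := by
      rw [add_sub_cancel_left, norm_smul_of_nonneg ha.le]
      field_simp
    _ ≤ K * r := by gcongr; exact hp.2.2.le

lemma contDiffOn_differenceQuotient (h : IsC1Field f D B K) (a r : ℝ) :
    ContDiffOn ℝ 1 (uncurry (differenceQuotient f a))
      (univ ×ˢ differenceQuotientDomain D a r) := by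
  have hfst : ContDiffOn ℝ 1 (fun q : ℝ × E × E => f q.1 q.2.1)
      (univ ×ˢ differenceQuotientDomain D a r) :=
    h.contDiffOn.comp (g := uncurry f) (f := fun q : ℝ × E × E => (q.1, q.2.1))
      (by fun_prop) fun q hq => ⟨mem_univ _, hq.2.1⟩
  have hadd : ContDiffOn ℝ 1 (fun q : ℝ × E × E => f q.1 (q.2.1 + a • q.2.2))
      (univ ×ˢ differenceQuotientDomain D a r) :=
    h.contDiffOn.comp (g := uncurry f) (f := fun q : ℝ × E × E => (q.1, q.2.1 + a • q.2.2))
      (by fun_prop) fun q hq => ⟨mem_univ _, hq.2.2.1⟩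
  exact hfst.prodMk ((hadd.sub hfst).const_smul a⁻¹)

lemma fderiv_differenceQuotient_apply (h : IsC1Field f D B K) (ha : a ≠ 0) (s : ℝ) {p : E × E}
    (hp : p ∈ differenceQuotientDomain D a r) (q : E × E) :
    fderiv ℝ (differenceQuotient f a s) p q = (fderiv ℝ (f s) p.1 q.1,
      a⁻¹ • (fderiv ℝ (f s) (p.1 + a • p.2) - fderiv ℝ (f s) p.1) q.1
        + fderiv ℝ (f s) (p.1 + a • p.2) q.2) := by
  have hfst : HasFDerivAt (fun p : E × E => f s p.1)
      (fderiv ℝ (f s) p.1 ∘L ContinuousLinearMap.fst ℝ E E) p :=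
    (h.hasFDerivAt_state s hp.1).differentiableAt.hasFDerivAt.comp p hasFDerivAt_fst
  have hadd : HasFDerivAt (fun p : E × E => f s (p.1 + a • p.2))
      (fderiv ℝ (f s) (p.1 + a • p.2) ∘L
        (ContinuousLinearMap.fst ℝ E E + a • ContinuousLinearMap.snd ℝ E E)) p :=
    (h.hasFDerivAt_state s hp.2.1).differentiableAt.hasFDerivAt.comp p
      (hasFDerivAt_fst.add (hasFDerivAt_snd.const_smul a))
  have hpair : HasFDerivAt (MLParareal.differenceQuotient f a s) _ p :=
    hfst.prodMk ((hadd.sub hfst).const_smul a⁻¹)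
  rw [hpair.fderiv]
  ext <;> simp [smul_sub, smul_add, ha]
  abel

lemma norm_fderiv_differenceQuotient_le (h : IsC1Field f D B K) (ha : 0 < a) (hK' : 0 ≤ K')
    (hf' : ∀ s, ∀ x ∈ D, ∀ y ∈ D, ‖fderiv ℝ (f s) x - fderiv ℝ (f s) y‖ ≤ K' * ‖x - y‖)
    (s : ℝ) {p : E × E} (hp : p ∈ differenceQuotientDomain D a r) :
    ‖fderiv ℝ (differenceQuotient f a s) p‖ ≤ K + K' * r := by
  have hK := h.nonneg_fderiv_bound hp.1
  have hr : 0 < r := (norm_nonneg _).trans_lt hp.2.2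
  refine ContinuousLinearMap.opNorm_le_bound _ (by positivity) fun q => ?_
  rw [h.fderiv_differenceQuotient_apply ha.ne' s hp q]
  have hq₁ : ‖q.1‖ ≤ ‖q‖ := norm_fst_le q
  have hq₂ : ‖q.2‖ ≤ ‖q‖ := norm_snd_le q
  have hsub : ‖fderiv ℝ (f s) (p.1 + a • p.2) - fderiv ℝ (f s) p.1‖ ≤ a * (K' * r) :=
    calc _ ≤ K' * ‖p.1 + a • p.2 - p.1‖ := hf' s _ hp.2.1 _ hp.1
      _ = a * (K' * ‖p.2‖) := by rw [add_sub_cancel_left, norm_smul_of_nonneg ha.le]; ring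
      _ ≤ a * (K' * r) := by gcongr; exact hp.2.2.le
  refine max_le ?_ ?_
  · refine ((fderiv ℝ (f s) p.1).le_of_opNorm_le_of_le (h.norm_fderiv_le s _ hp.1) hq₁).trans ?_
    gcongr
    exact le_add_of_nonneg_right (by positivity)
  · rw [add_comm K, add_mul]
    refine norm_add_le_of_le ?_
      (ContinuousLinearMap.le_of_opNorm_le_of_le _ (h.norm_fderiv_le s _ hp.2.1) hq₂)
    rw [norm_smul_of_nonneg (inv_nonneg.2 ha.le), inv_mul_le_iff₀ ha, ← mul_assoc]
    exact ContinuousLinearMap.le_of_opNorm_le_of_le _ hsub hq₁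

lemma differenceQuotient (h : IsC1Field f D B K) (ha : 0 < a) (hK' : 0 ≤ K')
    (hf' : ∀ s, ∀ x ∈ D, ∀ y ∈ D, ‖fderiv ℝ (f s) x - fderiv ℝ (f s) y‖ ≤ K' * ‖x - y‖)
    (r : ℝ) :
    IsC1Field (differenceQuotient f a) (differenceQuotientDomain D a r)
      (B + K * r) (K + K' * r) where
  isOpen := isOpen_differenceQuotientDomain h.isOpen a r
  convex := convex_differenceQuotientDomain h.convex a r
  contDiffOn := h.contDiffOn_differenceQuotient a r
  norm_le s _ hp := h.norm_differenceQuotient_le ha s hp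
  norm_fderiv_le s _ hp := h.norm_fderiv_differenceQuotient_le ha hK' hf' s hp

lemma shiftAverage_differenceQuotient [CompleteSpace E] {ν : Measure ℝ} [IsProbabilityMeasure ν]
    (h : IsC1Field f D B K) (a s : ℝ) {p : E × E} (hp : p ∈ differenceQuotientDomain D a r) :
    shiftAverage ν (MLParareal.differenceQuotient f a) s p =
      MLParareal.differenceQuotient (shiftAverage ν f) a s p := by
  have hfst := h.integrable_shift (ν := ν) s hp.1
  have hadd := h.integrable_shift (ν := ν) s hp.2.1
  have hquot : Integrable (fun r => a⁻¹ • (f (s + r) (p.1 + a • p.2) - f (s + r) p.1)) ν :=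
    (hadd.sub hfst).smul a⁻¹
  simp only [shiftAverage, MLParareal.differenceQuotient]
  rw [integral_pair hfst hquot, integral_smul, integral_sub hadd hfst]

end IsC1Field

lemma isIntegralCurveOn_differenceQuotient {w₁ w₂ : ℝ → E} {A : Set ℝ} (ha : a ≠ 0)
    (hw₁ : IsIntegralCurveOn w₁ f A) (hw₂ : IsIntegralCurveOn w₂ f A) :
    IsIntegralCurveOn (fun s => (w₁ s, a⁻¹ • (w₂ s - w₁ s))) (differenceQuotient f a) A := by
  intro s hs
  have hw : w₁ s + a • a⁻¹ • (w₂ s - w₁ s) = w₂ s := by rw [smul_inv_smul₀ ha, add_sub_cancel]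
  simp only [differenceQuotient, hw]
  exact (hw₁ s hs).prodMk (((hw₂ s hs).sub (hw₁ s hs)).const_smul a⁻¹)

lemma mapsTo_differenceQuotientDomain {w₁ w₂ : ℝ → E} {t b T : ℝ} (hK : 0 ≤ K) (ha : 0 < a)
    (hf : ∀ s, ∀ x ∈ D, ∀ y ∈ D, ‖f s x - f s y‖ ≤ K * ‖x - y‖)
    (hw₁ : IsIntegralCurveOn w₁ f (Icc t b)) (hw₂ : IsIntegralCurveOn w₂ f (Icc t b))
    (hw₁D : MapsTo w₁ (Icc t b) D) (hw₂D : MapsTo w₂ (Icc t b) D)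
    (h₀ : ‖w₂ t - w₁ t‖ ≤ a) (hT : b - t ≤ T) :
    MapsTo (fun s => (w₁ s, a⁻¹ • (w₂ s - w₁ s))) (Icc t b)
      (differenceQuotientDomain D a (Real.exp (K * T) + 1)) := by
  intro s hs
  have hw : w₁ s + a • a⁻¹ • (w₂ s - w₁ s) = w₂ s := by rw [smul_inv_smul₀ ha.ne', add_sub_cancel]
  refine ⟨hw₁D hs, by simpa only [hw] using hw₂D hs, ?_⟩
  calc ‖a⁻¹ • (w₂ s - w₁ s)‖ = a⁻¹ * ‖w₂ s - w₁ s‖ := norm_smul_of_nonneg (inv_nonneg.2 ha.le) _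
    _ ≤ a⁻¹ * (a * Real.exp (K * (s - t))) := by
      gcongr
      refine (norm_sub_le_mul_exp_of_isIntegralCurveOn hf hw₂ hw₁ hw₂D hw₁D s hs).trans ?_
      gcongr
    _ = Real.exp (K * (s - t)) := inv_mul_cancel_left₀ ha.ne' _
    _ ≤ Real.exp (K * T) := by gcongr; linarith [hs.2]
    _ < Real.exp (K * T) + 1 := lt_add_one _

/-- The factor with which the effect of time shifts of size `R` on solutions on an interval of
length `T` is Lipschitz in the initial value, for a vector field bounded by `B` with state
derivative bounded by `K` and `K'`-Lipschitz: `averagingConst` for the difference quotient field. -/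
noncomputable def averagingLipschitzConst (B K K' T : ℝ) : ℝ :=
  averagingConst (B + K * (Real.exp (K * T) + 1)) (K + K' * (Real.exp (K * T) + 1)) T

lemma averagingLipschitzConst_nonneg {T : ℝ} (hB : 0 ≤ B) (hK : 0 ≤ K) (hK' : 0 ≤ K')
    (hT : 0 ≤ T) : 0 ≤ averagingLipschitzConst B K K' T :=
  averagingConst_nonneg (by positivity) (by positivity) hT

section

variable [CompleteSpace E] {ν : Measure ℝ} [IsProbabilityMeasure ν] {w₁ w₂ v₁ v₂ : ℝ → E}
  {t b T : ℝ}

lemma IsC1Field.norm_sub_sub_sub_le_of_norm_sub_le (h : IsC1Field f D B K) (hK' : 0 ≤ K')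
    (hf' : ∀ s, ∀ x ∈ D, ∀ y ∈ D, ‖fderiv ℝ (f s) x - fderiv ℝ (f s) y‖ ≤ K' * ‖x - y‖)
    (hν : ∀ᵐ r ∂ν, |r| ≤ R)
    (hw₁ : IsIntegralCurveOn w₁ f (Icc t b)) (hw₂ : IsIntegralCurveOn w₂ f (Icc t b))
    (hv₁ : IsIntegralCurveOn v₁ (shiftAverage ν f) (Icc t b))
    (hv₂ : IsIntegralCurveOn v₂ (shiftAverage ν f) (Icc t b))
    (hw₁D : MapsTo w₁ (Icc t b) D) (hw₂D : MapsTo w₂ (Icc t b) D)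
    (hv₁D : MapsTo v₁ (Icc t b) D) (hv₂D : MapsTo v₂ (Icc t b) D)
    (h₁ : w₁ t = v₁ t) (h₂ : w₂ t = v₂ t) (hT : b - t ≤ T) (ha : 0 < a)
    (h₀ : ‖w₂ t - w₁ t‖ ≤ a) {s : ℝ} (hs : s ∈ Icc t b) :
    ‖(w₂ s - v₂ s) - (w₁ s - v₁ s)‖ ≤ R * averagingLipschitzConst B K K' T * a := by
  have hB := h.nonneg_bound (hw₁D hs)
  have hK := h.nonneg_fderiv_bound (hw₁D hs)
  have hwD := mapsTo_differenceQuotientDomain hK ha (fun s x hx y hy => h.norm_sub_le s hx hy)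
    hw₁ hw₂ hw₁D hw₂D h₀ hT
  have hvD := mapsTo_differenceQuotientDomain hK ha
    (fun s x hx y hy => h.norm_shiftAverage_sub_le s hx hy) hv₁ hv₂ hv₁D hv₂D
    (by rwa [← h₁, ← h₂]) hT
  have hv : IsIntegralCurveOn (fun s => (v₁ s, a⁻¹ • (v₂ s - v₁ s)))
      (shiftAverage ν (MLParareal.differenceQuotient f a)) (Icc t b) := fun r hr => by
    rw [h.shiftAverage_differenceQuotient a r (hvD hr)]
    exact isIntegralCurveOn_differenceQuotient ha.ne' hv₁ hv₂ r hr
  have hpair := (h.differenceQuotient ha hK' hf' _).norm_sub_le_mul_averagingConst hν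
    (isIntegralCurveOn_differenceQuotient ha.ne' hw₁ hw₂) hv hwD hvD (by rw [h₁, h₂]) hs
  calc ‖(w₂ s - v₂ s) - (w₁ s - v₁ s)‖
      = a * ‖a⁻¹ • (w₂ s - w₁ s) - a⁻¹ • (v₂ s - v₁ s)‖ := by
        rw [← smul_sub, norm_smul_of_nonneg (inv_nonneg.2 ha.le), mul_inv_cancel_left₀ ha.ne',
          sub_sub_sub_comm]
    _ ≤ a * (R * averagingLipschitzConst B K K' T) := by
        gcongr
        refine (norm_snd_le _).trans (hpair.trans ?_)
        gcongr
        · exact nonneg_of_ae_abs_le hν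
        · exact averagingConst_mono (by positivity) (by positivity) (by linarith [hs.2])
    _ = R * averagingLipschitzConst B K K' T * a := mul_comm _ _

theorem IsC1Field.norm_sub_sub_sub_le_mul_averagingLipschitzConst
    (h : IsC1Field f D B K) (hK' : 0 ≤ K')
    (hf' : ∀ s, ∀ x ∈ D, ∀ y ∈ D, ‖fderiv ℝ (f s) x - fderiv ℝ (f s) y‖ ≤ K' * ‖x - y‖)
    (hν : ∀ᵐ r ∂ν, |r| ≤ R)
    (hw₁ : IsIntegralCurveOn w₁ f (Icc t b)) (hw₂ : IsIntegralCurveOn w₂ f (Icc t b))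
    (hv₁ : IsIntegralCurveOn v₁ (shiftAverage ν f) (Icc t b))
    (hv₂ : IsIntegralCurveOn v₂ (shiftAverage ν f) (Icc t b))
    (hw₁D : MapsTo w₁ (Icc t b) D) (hw₂D : MapsTo w₂ (Icc t b) D)
    (hv₁D : MapsTo v₁ (Icc t b) D) (hv₂D : MapsTo v₂ (Icc t b) D)
    (h₁ : w₁ t = v₁ t) (h₂ : w₂ t = v₂ t) (hT : b - t ≤ T) {s : ℝ} (hs : s ∈ Icc t b) :
    ‖(w₂ s - v₂ s) - (w₁ s - v₁ s)‖ ≤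
      R * averagingLipschitzConst B K K' T * ‖w₂ t - w₁ t‖ := by
  have hlim : Tendsto (fun a => R * averagingLipschitzConst B K K' T * a)
      (𝓝[>] ‖w₂ t - w₁ t‖) (𝓝 (R * averagingLipschitzConst B K K' T * ‖w₂ t - w₁ t‖)) :=
    ((continuous_const_mul _).tendsto _).mono_left nhdsWithin_le_nhds
  refine ge_of_tendsto hlim (eventually_mem_nhdsWithin.mono fun a (ha : _ < a) => ?_)
  exact h.norm_sub_sub_sub_le_of_norm_sub_le hK' hf' hν hw₁ hw₂ hv₁ hv₂ hw₁D hw₂D hv₁D hv₂D h₁ h₂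
    hT ((norm_nonneg _).trans_lt ha) ha.le hs

end

end DifferenceQuotient

section Modulation

lemma contDiff_exp_smul {𝔸 : Type*} [NormedRing 𝔸] [NormedAlgebra ℝ 𝔸] [CompleteSpace 𝔸]
    {n : WithTop ℕ∞} (a : 𝔸) : ContDiff ℝ n fun τ : ℝ => NormedSpace.exp (τ • a) :=
  contDiff_iff_contDiffAt.2 fun τ =>
    (NormedSpace.exp_analytic (𝕂 := ℝ) (τ • a)).contDiffAt.comp τ
      (contDiff_id.smul contDiff_const).contDiffAt

lemma exp_neg_smul_apply_mem {E : Type*} [NormedAddCommGroup E] [NormedSpace ℝ E] {A : E →L[ℝ] E}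
    {D : Set E} (hinv : ∀ τ : ℝ, ∀ v ∈ D, NormedSpace.exp (τ • A) v ∈ D) (τ : ℝ)
    {v : E} (hv : v ∈ D) : NormedSpace.exp (-(τ • A)) v ∈ D := by
  simpa only [neg_smul] using hinv (-τ) v hv

variable {V : Type*} [NormedAddCommGroup V] [InnerProductSpace ℝ V] {A : V →L[ℝ] V}
  {Nl : V → V} {D : Set V} {M M' M'' : ℝ}

lemma fderiv_modulationRHS (ε s : ℝ) {x : V}
    (hN : DifferentiableAt ℝ Nl (NormedSpace.exp (-((s / ε) • A)) x)) :
    fderiv ℝ (modulationRHS A Nl ε s) x = NormedSpace.exp ((s / ε) • A) ∘L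
      fderiv ℝ Nl (NormedSpace.exp (-((s / ε) • A)) x) ∘L NormedSpace.exp (-((s / ε) • A)) :=
  ((NormedSpace.exp ((s / ε) • A)).hasFDerivAt.comp x
    (hN.hasFDerivAt.comp x (NormedSpace.exp (-((s / ε) • A))).hasFDerivAt)).fderiv

variable [CompleteSpace V]

lemma exp_smul_mem_unitary_of_adjoint_eq_neg (hA : A.adjoint = -A) (τ : ℝ) :
    NormedSpace.exp (τ • A) ∈ unitary (V →L[ℝ] V) := by
  have hskew : τ • A ∈ skewAdjoint (V →L[ℝ] V) := by
    rw [skewAdjoint.mem_iff, ContinuousLinearMap.star_eq_adjoint, map_smulₛₗ, hA]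
    simp
  let : NormedAlgebra ℚ (V →L[ℝ] V) := NormedAlgebra.restrictScalars ℚ ℝ (V →L[ℝ] V)
  exact NormedSpace.exp_mem_unitary_of_mem_skewAdjoint hskew

lemma norm_exp_smul_apply (hA : A.adjoint = -A) (τ : ℝ) (v : V) :
    ‖NormedSpace.exp (τ • A) v‖ = ‖v‖ :=
  ContinuousLinearMap.norm_map_of_mem_unitary (exp_smul_mem_unitary_of_adjoint_eq_neg hA τ) v

lemma norm_exp_neg_smul_apply (hA : A.adjoint = -A) (τ : ℝ) (v : V) :
    ‖NormedSpace.exp (-(τ • A)) v‖ = ‖v‖ := by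
  rw [← neg_smul, norm_exp_smul_apply hA]

lemma norm_exp_smul_comp_comp_le (hA : A.adjoint = -A) (τ : ℝ) (B : V →L[ℝ] V) :
    ‖NormedSpace.exp (τ • A) ∘L B ∘L NormedSpace.exp (-(τ • A))‖ ≤ ‖B‖ :=
  ContinuousLinearMap.opNorm_le_bound _ (norm_nonneg B) fun v => by
    simpa only [ContinuousLinearMap.comp_apply, norm_exp_smul_apply hA,
      norm_exp_neg_smul_apply hA] using B.le_opNorm (NormedSpace.exp (-(τ • A)) v)

lemma contDiffOn_modulationRHS {n : WithTop ℕ∞} (ε : ℝ)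
    (hinv : ∀ τ : ℝ, ∀ v ∈ D, NormedSpace.exp (τ • A) v ∈ D) (hN : ContDiffOn ℝ n Nl D) :
    ContDiffOn ℝ n (uncurry (modulationRHS A Nl ε)) (univ ×ˢ D) := by
  have hexp : ContDiff ℝ n fun p : ℝ × V => NormedSpace.exp ((p.1 / ε) • A) :=
    (contDiff_exp_smul A).comp (contDiff_fst.div_const ε)
  have hexp' : ContDiff ℝ n fun p : ℝ × V => NormedSpace.exp (-((p.1 / ε) • A)) := by
    simp_rw [← neg_smul]
    exact (contDiff_exp_smul A).comp (contDiff_fst.div_const ε).neg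
  exact hexp.contDiffOn.clm_apply (hN.comp (hexp'.clm_apply contDiff_snd).contDiffOn
    fun p hp => exp_neg_smul_apply_mem hinv _ hp.2)

lemma isC1Field_modulationRHS (ε : ℝ) (hA : A.adjoint = -A) (hD : IsOpen D) (hDc : Convex ℝ D)
    (hinv : ∀ τ : ℝ, ∀ v ∈ D, NormedSpace.exp (τ • A) v ∈ D) (hN : ContDiffOn ℝ 1 Nl D)
    (hM : ∀ v ∈ D, ‖Nl v‖ ≤ M) (hM' : ∀ v ∈ D, ‖fderiv ℝ Nl v‖ ≤ M') :
    IsC1Field (modulationRHS A Nl ε) D M M' where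
  isOpen := hD
  convex := hDc
  contDiffOn := contDiffOn_modulationRHS ε hinv hN
  norm_le s x hx := by
    rw [modulationRHS, modulated, norm_exp_smul_apply hA]
    exact hM _ (exp_neg_smul_apply_mem hinv _ hx)
  norm_fderiv_le s x hx := by
    have hx' := exp_neg_smul_apply_mem hinv (s / ε) hx
    rw [fderiv_modulationRHS ε s ((hN.differentiableOn one_ne_zero).differentiableAt
      (hD.mem_nhds hx'))]
    exact (norm_exp_smul_comp_comp_le hA _ _).trans (hM' _ hx')

lemma norm_fderiv_modulationRHS_sub_le (ε : ℝ) (hA : A.adjoint = -A) (hD : IsOpen D)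
    (hDc : Convex ℝ D) (hinv : ∀ τ : ℝ, ∀ v ∈ D, NormedSpace.exp (τ • A) v ∈ D)
    (hN : ContDiffOn ℝ 2 Nl D) (hM'' : ∀ v ∈ D, ‖fderiv ℝ (fderiv ℝ Nl) v‖ ≤ M'') (s : ℝ)
    {x y : V} (hx : x ∈ D) (hy : y ∈ D) :
    ‖fderiv ℝ (modulationRHS A Nl ε s) x - fderiv ℝ (modulationRHS A Nl ε s) y‖ ≤
      M'' * ‖x - y‖ := by
  have hx' := exp_neg_smul_apply_mem hinv (s / ε) hx
  have hy' := exp_neg_smul_apply_mem hinv (s / ε) hy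
  have hdiff : ∀ v ∈ D, DifferentiableAt ℝ Nl v := fun v hv =>
    (hN.differentiableOn two_ne_zero).differentiableAt (hD.mem_nhds hv)
  have hdiff' : ∀ v ∈ D, DifferentiableAt ℝ (fderiv ℝ Nl) v := fun v hv =>
    ((hN.fderiv_of_isOpen hD (m := 1) (by norm_num)).differentiableOn
      one_ne_zero).differentiableAt (hD.mem_nhds hv)
  rw [fderiv_modulationRHS ε s (hdiff _ hx'), fderiv_modulationRHS ε s (hdiff _ hy'),
    ← ContinuousLinearMap.comp_sub, ← ContinuousLinearMap.sub_comp]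
  refine (norm_exp_smul_comp_comp_le hA _ _).trans
    ((hDc.norm_image_sub_le_of_norm_fderiv_le hdiff' hM'' hy' hx').trans ?_)
  rw [← map_sub, norm_exp_neg_smul_apply hA]

end Modulation

section Kernel

variable {ρ : ℝ → ℝ} {a : ℝ}

/-- The distribution of `a σ` when `σ` has the density `ρ` on `[-1/2, 1/2]`; averaging over a
window `η` in the fast time is averaging over time shifts with this distribution, `a = η ε`. -/
noncomputable def kernelMeasure (ρ : ℝ → ℝ) (a : ℝ) : Measure ℝ :=
  ((volume.restrict (Ioc (-(1 / 2) : ℝ) (1 / 2))).withDensity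
    fun σ => ENNReal.ofReal (ρ σ)).map (a * ·)

namespace IsKernel

lemma integrable_restrict (hρ : IsKernel ρ) :
    Integrable ρ (volume.restrict (Ioc (-(1 / 2) : ℝ) (1 / 2))) :=
  (intervalIntegrable_iff_integrableOn_Ioc_of_le (by norm_num)).1 hρ.integrable

lemma ae_nonneg (hρ : IsKernel ρ) :
    ∀ᵐ σ ∂volume.restrict (Ioc (-(1 / 2) : ℝ) (1 / 2)), 0 ≤ ρ σ :=
  (ae_restrict_mem measurableSet_Ioc).mono fun _ hσ => hρ.nonneg _ (Ioc_subset_Icc_self hσ)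

lemma isProbabilityMeasure (hρ : IsKernel ρ) (a : ℝ) :
    IsProbabilityMeasure (kernelMeasure ρ a) := by
  have : IsProbabilityMeasure ((volume.restrict (Ioc (-(1 / 2) : ℝ) (1 / 2))).withDensity
      fun σ => ENNReal.ofReal (ρ σ)) := by
    refine ⟨?_⟩
    rw [withDensity_apply _ MeasurableSet.univ, Measure.restrict_univ,
      ← ofReal_integral_eq_lintegral_ofReal hρ.integrable_restrict hρ.ae_nonneg,
      ← intervalIntegral.integral_of_le (by norm_num), hρ.integral_eq_one, ENNReal.ofReal_one]
  exact Measure.isProbabilityMeasure_map (measurable_const_mul a).aemeasurable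

lemma integral_kernelMeasure {F : Type*} [NormedAddCommGroup F] [NormedSpace ℝ F]
    (hρ : IsKernel ρ) (ha : a ≠ 0) (g : ℝ → F) :
    ∫ r, g r ∂kernelMeasure ρ a = ∫ σ in (-(1 / 2) : ℝ)..(1 / 2), ρ σ • g (a * σ) := by
  rw [kernelMeasure, (measurableEmbedding_mulLeft₀ ha).integral_map,
    integral_withDensity_eq_integral_toReal_smul₀
      hρ.integrable_restrict.aemeasurable.ennreal_ofReal
      (ae_of_all _ fun _ => ENNReal.ofReal_lt_top),
    intervalIntegral.integral_of_le (by norm_num)]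
  exact integral_congr_ae (hρ.ae_nonneg.mono fun σ hσ => by simp only [ENNReal.toReal_ofReal hσ])

end IsKernel

lemma ae_kernelMeasure_abs_le (ρ : ℝ → ℝ) (ha : 0 ≤ a) :
    ∀ᵐ r ∂kernelMeasure ρ a, |r| ≤ a / 2 := by
  rw [kernelMeasure, ae_map_iff (measurable_const_mul a).aemeasurable
    (measurableSet_le continuous_abs.measurable measurable_const)]
  refine (withDensity_absolutelyContinuous _ _).ae_le
    ((ae_restrict_mem measurableSet_Ioc).mono fun σ hσ => ?_)
  rw [abs_mul, abs_of_nonneg ha, div_eq_mul_one_div]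
  exact mul_le_mul_of_nonneg_left (abs_le.2 ⟨hσ.1.le, hσ.2⟩) ha

lemma averagedRHS_eq_shiftAverage {V : Type*} [NormedAddCommGroup V] [InnerProductSpace ℝ V]
    [CompleteSpace V] (A : V →L[ℝ] V) (Nl : V → V) {ε η : ℝ}
    (hε : 0 < ε) (hη : 0 < η) (hρ : IsKernel ρ) :
    averagedRHS A Nl ε ρ η = shiftAverage (kernelMeasure ρ (η * ε)) (modulationRHS A Nl ε) := by
  ext t x
  have hscale := intervalIntegral.integral_comp_div (a := -(η / 2)) (b := η / 2)
    (fun σ => ρ σ • modulated A Nl (t / ε + η * σ) x) hη.ne'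
  have hη₂ : η / 2 / η = 1 / 2 := by field_simp
  simp only [neg_div, hη₂, mul_div_cancel₀ _ hη.ne'] at hscale
  rw [shiftAverage, hρ.integral_kernelMeasure (mul_pos hη hε).ne', averagedRHS, hscale, smul_smul,
    one_div_mul_cancel hη.ne', one_smul]
  refine intervalIntegral.integral_congr fun σ _ => ?_
  simp only [modulationRHS]
  congr 2
  field_simp

end Kernel

section Recursion

variable {α β : ℝ}

/-- The accumulated effect, after `j` iterations and `n` steps of the Parareal iteration, of a
unit error in each step of the serial sweep with the coarse propagator. -/
noncomputable def binomialMajorant (α β : ℝ) (j n : ℕ) : ℝ :=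
  n.choose (j + 1) * α ^ j * β ^ (n - j - 1)

/-- The accumulated effect, after `n` steps of the Parareal iteration with any number of
iterations, of a unit error of the fine propagator in each step. -/
noncomputable def geometricMajorant (α β : ℝ) (n : ℕ) : ℝ :=
  β ^ (n - 1) * ∑ i ∈ Finset.range n, (1 + α) ^ i

lemma binomialMajorant_zero_right (α β : ℝ) (j : ℕ) : binomialMajorant α β j 0 = 0 := by
  simp [binomialMajorant]

lemma binomialMajorant_succ_succ (α β : ℝ) (j n : ℕ) :
    binomialMajorant α β (j + 1) (n + 1) =
      α * binomialMajorant α β j n + β * binomialMajorant α β (j + 1) n := by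
  have hpow : (n.choose (j + 2) : ℝ) * β ^ (n - j - 1) =
      n.choose (j + 2) * (β * β ^ (n - (j + 1) - 1)) := by
    rcases lt_or_ge n (j + 2) with hn | hn
    · simp [Nat.choose_eq_zero_of_lt hn]
    · rw [← pow_succ', show n - (j + 1) - 1 + 1 = n - j - 1 by omega]
  rw [binomialMajorant, binomialMajorant, binomialMajorant, Nat.choose_succ_succ, Nat.cast_add,
    show n + 1 - (j + 1) - 1 = n - j - 1 by omega]
  linear_combination α ^ (j + 1) * hpow

lemma mul_binomialMajorant_zero_add_one_le (hβ : 1 ≤ β) (α : ℝ) (n : ℕ) :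
    β * binomialMajorant α β 0 n + 1 ≤ binomialMajorant α β 0 (n + 1) := by
  have hpow : β * (n * β ^ (n - 1)) = n * β ^ n := by
    cases n with
    | zero => simp
    | succ n => rw [Nat.add_sub_cancel]; ring
  simp only [binomialMajorant, zero_add, Nat.choose_one_right, pow_zero, mul_one, Nat.sub_zero,
    Nat.add_sub_cancel, hpow, Nat.cast_succ, add_mul, one_mul]
  gcongr
  exact one_le_pow₀ hβ

lemma geometricMajorant_zero (α β : ℝ) : geometricMajorant α β 0 = 0 := by
  simp [geometricMajorant]

lemma geometricMajorant_nonneg (hα : 0 ≤ α) (hβ : 0 ≤ β) (n : ℕ) :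
    0 ≤ geometricMajorant α β n :=
  mul_nonneg (by positivity) (Finset.sum_nonneg fun i _ => by positivity)

lemma geometricMajorant_monotone (hα : 0 ≤ α) (hβ : 1 ≤ β) : Monotone (geometricMajorant α β) := by
  intro m n hmn
  have : 0 ≤ β := zero_le_one.trans hβ
  refine mul_le_mul (pow_le_pow_right₀ hβ (Nat.sub_le_sub_right hmn 1)) ?_
    (Finset.sum_nonneg fun i _ => by positivity) (by positivity)
  exact Finset.sum_le_sum_of_subset_of_nonneg (Finset.range_subset_range.2 hmn)
    fun i _ _ => by positivity

lemma add_geometricMajorant_le_succ (hα : 0 ≤ α) (hβ : 1 ≤ β) (n : ℕ) :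
    α * geometricMajorant α β n + β * geometricMajorant α β n + 1 ≤
      geometricMajorant α β (n + 1) := by
  set S := ∑ i ∈ Finset.range n, (1 + α) ^ i with hS
  have hS₀ : 0 ≤ S := Finset.sum_nonneg fun i _ => by positivity
  have hmul : β * (β ^ (n - 1) * S) = β ^ n * S := by
    cases n with
    | zero => simp [hS]
    | succ n => rw [Nat.add_sub_cancel]; ring
  have hle : β ^ (n - 1) * S ≤ β ^ n * S := by gcongr; exact Nat.sub_le n 1
  calc α * (β ^ (n - 1) * S) + β * (β ^ (n - 1) * S) + 1
      ≤ α * (β ^ n * S) + β ^ n * S + β ^ n := by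
        rw [hmul]
        gcongr
        exact one_le_pow₀ hβ
    _ = geometricMajorant α β (n + 1) := by
        rw [geometricMajorant, geom_sum_succ, ← hS, Nat.add_sub_cancel]
        ring

theorem le_add_of_parareal_recursion {e : ℕ → ℕ → ℝ} {γ δ : ℝ} {N k : ℕ} (hα : 0 ≤ α)
    (hβ : 1 ≤ β) (hγ : 0 ≤ γ) (hδ : 0 ≤ δ) (h₀ : ∀ j ≤ k, e j 0 ≤ 0)
    (hserial : ∀ n < N, e 0 (n + 1) ≤ β * e 0 n + γ)
    (hstep : ∀ n < N, ∀ j < k, e (j + 1) (n + 1) ≤ α * e j n + β * e (j + 1) n + δ) :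
    ∀ n ≤ N, ∀ j ≤ k,
      e j n ≤ γ * binomialMajorant α β j n + δ * geometricMajorant α β n := by
  have hβ₀ : 0 ≤ β := zero_le_one.trans hβ
  intro n
  induction n with
  | zero =>
    intro _ j hj
    simpa [binomialMajorant_zero_right, geometricMajorant_zero] using h₀ j hj
  | succ n ih =>
    intro hn j hj
    have hgeom := add_geometricMajorant_le_succ hα hβ n
    have hgeom₀ := geometricMajorant_nonneg hα hβ₀ n
    cases j with
    | zero =>
      calc e 0 (n + 1) ≤ β * e 0 n + γ := hserial n hn
        _ ≤ β * (γ * binomialMajorant α β 0 n + δ * geometricMajorant α β n) + γ := by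
          gcongr
          exact ih (by omega) 0 hj
        _ = γ * (β * binomialMajorant α β 0 n + 1) + δ * (β * geometricMajorant α β n) := by ring
        _ ≤ _ := by
          gcongr
          · exact mul_binomialMajorant_zero_add_one_le hβ α n
          · linarith [mul_nonneg hα hgeom₀]
    | succ j =>
      calc e (j + 1) (n + 1) ≤ α * e j n + β * e (j + 1) n + δ := hstep n hn j hj
        _ ≤ α * (γ * binomialMajorant α β j n + δ * geometricMajorant α β n) +
            β * (γ * binomialMajorant α β (j + 1) n + δ * geometricMajorant α β n) + δ := by
          gcongr
          exacts [ih (by omega) j (by omega), ih (by omega) (j + 1) hj]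
        _ = γ * binomialMajorant α β (j + 1) (n + 1) +
            δ * (α * geometricMajorant α β n + β * geometricMajorant α β n + 1) := by
          rw [binomialMajorant_succ_succ]
          ring
        _ ≤ _ := by gcongr

lemma exists_mul_pow_eq_geom_sum (hα : 0 ≤ α) (N : ℕ) :
    ∃ α₀ ∈ Icc 0 α, N * (1 + α₀) ^ (N - 1) = ∑ i ∈ Finset.range N, (1 + α) ^ i := by
  have hcont : ContinuousOn (fun y : ℝ => (N : ℝ) * (1 + y) ^ (N - 1)) (Icc 0 α) := by fun_prop
  have hlower : ∀ i ∈ Finset.range N, 1 ≤ (1 + α) ^ i := fun i _ => one_le_pow₀ (by linarith)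
  have hupper : ∀ i ∈ Finset.range N, (1 + α) ^ i ≤ (1 + α) ^ (N - 1) := fun i hi =>
    pow_le_pow_right₀ (by linarith) (Nat.le_sub_one_of_lt (Finset.mem_range.1 hi))
  refine intermediate_value_Icc hα hcont ⟨?_, ?_⟩
  · simpa using Finset.card_nsmul_le_sum _ _ _ hlower
  · simpa using Finset.sum_le_card_nsmul _ _ _ hupper

lemma pow_sub_one_eq_of_mul_pow_eq_geom_sum {α₀ : ℝ} {N : ℕ}
    (hα₀ : N * (1 + α₀) ^ (N - 1) = ∑ i ∈ Finset.range N, (1 + α) ^ i) :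
    (1 + α) ^ N - 1 = N * α * (1 + α₀) ^ (N - 1) := by
  rw [← mul_geom_sum, ← hα₀]
  ring

lemma le_mul_pow_of_le_mul_add {e : ℕ → ℝ} {q δ : ℝ} {N : ℕ} (hq : 1 ≤ q) (hδ : 0 ≤ δ)
    (h₀ : e 0 ≤ 0) (hstep : ∀ n < N, e (n + 1) ≤ q * e n + δ) :
    ∀ n ≤ N, e n ≤ n * δ * q ^ n := by
  intro n
  induction n with
  | zero => simpa using h₀
  | succ n ih =>
    intro hn
    calc e (n + 1) ≤ q * e n + δ := hstep n hn
      _ ≤ q * (n * δ * q ^ n) + δ * q ^ (n + 1) := by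
        gcongr
        · exact ih (by omega)
        · exact le_mul_of_one_le_right hδ (one_le_pow₀ hq)
      _ = (n + 1 : ℕ) * δ * q ^ (n + 1) := by push_cast; ring

end Recursion

section Propagators

variable {V : Type*} [NormedAddCommGroup V] {Φ g G F : ℝ → V → V} {S : Set V} {h t : ℝ} {x : V}
  {y : ℕ → V} {N : ℕ}

lemma norm_sub_serialSteps_le {q δ : ℝ} (hq : 1 ≤ q) (hδ : 0 ≤ δ) (hy₀ : y 0 = x)
    (hy : ∀ n < N, y (n + 1) = Φ (t + n * h) (y n))
    (hΦ : ∀ n < N, ‖Φ (t + n * h) (y n) - Φ (t + n * h) (serialSteps g h t x n)‖ ≤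
      q * ‖y n - serialSteps g h t x n‖)
    (hg : ∀ n < N, ‖Φ (t + n * h) (serialSteps g h t x n) -
      g (t + n * h) (serialSteps g h t x n)‖ ≤ δ) :
    ∀ n ≤ N, ‖y n - serialSteps g h t x n‖ ≤ n * δ * q ^ n := by
  refine le_mul_pow_of_le_mul_add hq hδ (by simp [serialSteps, hy₀]) fun n hn => ?_
  rw [hy n hn, serialSteps]
  exact (norm_sub_le_norm_sub_add_norm_sub _ _ _).trans (add_le_add (hΦ n hn) (hg n hn))

lemma iterate_zero_right (G F : ℝ → V → V) (h t : ℝ) (x : V) (j : ℕ) :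
    iterate G F h t x j 0 = x := by
  cases j <;> rfl

lemma iterate_zero_succ (G F : ℝ → V → V) (h t : ℝ) (x : V) (n : ℕ) :
    iterate G F h t x 0 (n + 1) = G (t + n * h) (iterate G F h t x 0 n) := by
  rw [iterate]

lemma iterate_succ_succ (G F : ℝ → V → V) (h t : ℝ) (x : V) (j n : ℕ) :
    iterate G F h t x (j + 1) (n + 1) = G (t + n * h) (iterate G F h t x (j + 1) n) +
      F (t + n * h) (iterate G F h t x j n) - G (t + n * h) (iterate G F h t x j n) := by
  rw [iterate]

theorem norm_sub_iterate_le {α β γ δ : ℝ} {k : ℕ} (hα : 0 ≤ α) (hβ : 1 ≤ β) (hγ : 0 ≤ γ)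
    (hδ : 0 ≤ δ) (hy₀ : y 0 = x) (hy : ∀ n < N, y (n + 1) = Φ (t + n * h) (y n))
    (hyS : ∀ n < N, y n ∈ S) (hiter : ∀ n < N, ∀ j ≤ k, iterate G F h t x j n ∈ S)
    (hΦG : ∀ n < N, ∀ u ∈ S, ‖Φ (t + n * h) u - G (t + n * h) u‖ ≤ γ)
    (hΦG' : ∀ n < N, ∀ u ∈ S, ∀ v ∈ S, ‖(Φ (t + n * h) u - G (t + n * h) u) -
      (Φ (t + n * h) v - G (t + n * h) v)‖ ≤ α * ‖u - v‖)
    (hG : ∀ n < N, ∀ u ∈ S, ∀ v ∈ S, ‖G (t + n * h) u - G (t + n * h) v‖ ≤ β * ‖u - v‖)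
    (hF : ∀ n < N, ∀ j < k, ‖Φ (t + n * h) (iterate G F h t x j n) -
      F (t + n * h) (iterate G F h t x j n)‖ ≤ δ) :
    ∀ n ≤ N, ∀ j ≤ k, ‖y n - iterate G F h t x j n‖ ≤
      γ * binomialMajorant α β j n + δ * geometricMajorant α β n := by
  refine le_add_of_parareal_recursion (e := fun j n => ‖y n - iterate G F h t x j n‖)
    hα hβ hγ hδ (fun j _ => by simp [iterate_zero_right, hy₀]) (fun n hn => ?_)
    fun n hn j hj => ?_
  · rw [hy n hn, iterate_zero_succ]
    exact (norm_sub_le_norm_sub_add_norm_sub _ (G (t + n * h) (y n)) _).trans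
      ((add_le_add (hΦG n hn _ (hyS n hn))
        (hG n hn _ (hyS n hn) _ (hiter n hn 0 (Nat.zero_le _)))).trans_eq (add_comm _ _))
  · have hsplit : y (n + 1) - iterate G F h t x (j + 1) (n + 1) =
        ((Φ (t + n * h) (y n) - G (t + n * h) (y n)) -
          (Φ (t + n * h) (iterate G F h t x j n) - G (t + n * h) (iterate G F h t x j n))) +
        (G (t + n * h) (y n) - G (t + n * h) (iterate G F h t x (j + 1) n)) +
        (Φ (t + n * h) (iterate G F h t x j n) - F (t + n * h) (iterate G F h t x j n)) := by
      rw [hy n hn, iterate_succ_succ]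
      abel
    rw [hsplit]
    exact norm_add₃_le.trans (add_le_add_three
      (hΦG' n hn _ (hyS n hn) _ (hiter n hn j hj.le))
      (hG n hn _ (hyS n hn) _ (hiter n hn (j + 1) hj)) (hF n hn j hj))

end Propagators

section ExactPropagator

variable {V : Type*} [NormedAddCommGroup V] [InnerProductSpace ℝ V] {f : ℝ → V → V} {D : Set V}
  {K t t' b r r' : ℝ} {x y : V} {w v : ℝ → V}

namespace IsSolution

lemma isIntegralCurveOn (hw : IsSolution f D t b x w) : IsIntegralCurveOn w f (Icc t b) :=
  fun s hs => (hw.2 s hs).2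

lemma mapsTo (hw : IsSolution f D t b x w) : MapsTo w (Icc t b) D :=
  fun s hs => (hw.2 s hs).1

lemma restrict (hw : IsSolution f D t b x w) (ht : t ≤ t') : IsSolution f D t' b (w t') w :=
  ⟨rfl, fun s hs => ⟨hw.mapsTo (Icc_subset_Icc_left ht hs),
    (hw.isIntegralCurveOn s (Icc_subset_Icc_left ht hs)).mono (Icc_subset_Icc_left ht)⟩⟩

lemma norm_sub_le (hf : ∀ s, ∀ x ∈ D, ∀ y ∈ D, ‖f s x - f s y‖ ≤ K * ‖x - y‖)
    (hw : IsSolution f D t b x w) (hv : IsSolution f D t b y v) {s : ℝ} (hs : s ∈ Icc t b) :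
    ‖w s - v s‖ ≤ ‖x - y‖ * Real.exp (K * (s - t)) := by
  rw [← hw.1, ← hv.1]
  exact norm_sub_le_mul_exp_of_isIntegralCurveOn hf hw.isIntegralCurveOn hv.isIntegralCurveOn
    hw.mapsTo hv.mapsTo s hs

end IsSolution

lemma isSolution_exactProp (H : ∃ w, IsSolution f D t b x w) :
    IsSolution f D t b x fun s => exactProp f D b t (s - t) x := by
  simpa only [exactProp, dif_pos H, add_sub_cancel] using H.choose_spec

lemma exactProp_zero (f : ℝ → V → V) (D : Set V) (b t : ℝ) (x : V) :
    exactProp f D b t 0 x = x := by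
  rw [exactProp]
  split_ifs with H
  · rw [add_zero, H.choose_spec.1]
  · rfl

lemma norm_exactProp_sub_le (hf : ∀ s, ∀ x ∈ D, ∀ y ∈ D, ‖f s x - f s y‖ ≤ K * ‖x - y‖)
    (hx : ∃ w, IsSolution f D t b x w) (hy : ∃ w, IsSolution f D t b y w) (hr : 0 ≤ r)
    (hrb : t + r ≤ b) :
    ‖exactProp f D b t r x - exactProp f D b t r y‖ ≤ Real.exp (K * r) * ‖x - y‖ := by
  simpa only [add_sub_cancel_left, mul_comm ‖x - y‖] using
    (isSolution_exactProp hx).norm_sub_le hf (isSolution_exactProp hy)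
      (s := t + r) ⟨by linarith, hrb⟩

lemma exactProp_add (hf : ∀ s, ∀ x ∈ D, ∀ y ∈ D, ‖f s x - f s y‖ ≤ K * ‖x - y‖)
    (hx : ∃ w, IsSolution f D t b x w) (hr : 0 ≤ r) (hr' : 0 ≤ r') (hb : t + r + r' ≤ b) :
    exactProp f D b t (r + r') x = exactProp f D b (t + r) r' (exactProp f D b t r x) := by
  have hrestrict := (isSolution_exactProp hx).restrict (t' := t + r) (by linarith)
  simp only [add_sub_cancel_left] at hrestrict
  have hunique := hrestrict.norm_sub_le hf (isSolution_exactProp ⟨_, hrestrict⟩)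
    (s := t + r + r') ⟨by linarith, hb⟩
  simp only [sub_self, norm_zero, zero_mul, norm_le_zero_iff, sub_eq_zero,
    add_sub_cancel_left] at hunique
  rw [← hunique]
  congr 1
  ring

end ExactPropagator

lemma norm_sub_le_of_hasSum_smul {ι V : Type*} [NormedAddCommGroup V] [NormedSpace ℝ V]
    {a m : ι → ℝ} {c c' : ι → V} {u u' : V} {B r : ℝ} (ha : ∀ j, 0 ≤ a j)
    (hu : HasSum (fun j => a j • c j) u) (hu' : HasSum (fun j => a j • c' j) u')
    (hm : HasSum (fun j => a j * m j) B) (hc : ∀ j, ‖c j - c' j‖ ≤ m j * r) :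
    ‖u - u'‖ ≤ B * r := by
  refine (hu.sub hu').norm_le_of_bounded (hm.mul_right r) fun j => ?_
  rw [← smul_sub, norm_smul_of_nonneg (ha j), mul_assoc]
  exact mul_le_mul_of_nonneg_left (hc j) (ha j)

lemma gridPoint_bounds {n N : ℕ} {t s T : ℝ} (hn : n < N) (ht : 0 ≤ t) (hs : 0 ≤ s)
    (hT : t + N * s ≤ T) : 0 ≤ t + n * s ∧ t + n * s + s ≤ T := by
  have hle : ((n : ℝ) + 1) * s ≤ N * s := by
    gcongr
    exact_mod_cast hn
  exact ⟨by positivity, by linarith⟩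

/-- A constant `C` for which the error bounds hold: it dominates all constants that come from the
exact and the averaged equation and from the truncation error. -/
noncomputable def errorConst (M T C₁ : ℝ) : ℝ :=
  1 + Real.exp (M * T) + C₁ + averagingConst M M T + averagingLipschitzConst M M M T

section ErrorConst

variable {M T C₁ : ℝ}

lemma one_le_errorConst (hM : 0 ≤ M) (hT : 0 ≤ T) (hC₁ : 0 ≤ C₁) : 1 ≤ errorConst M T C₁ := by
  have := averagingConst_nonneg hM hM hT
  have := averagingLipschitzConst_nonneg hM hM hM hT
  rw [errorConst]
  linarith [Real.exp_pos (M * T)]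

lemma exp_le_errorConst (hM : 0 ≤ M) (hT : 0 ≤ T) (hC₁ : 0 ≤ C₁) :
    Real.exp (M * T) ≤ errorConst M T C₁ := by
  have := averagingConst_nonneg hM hM hT
  have := averagingLipschitzConst_nonneg hM hM hM hT
  rw [errorConst]
  linarith

lemma le_errorConst (hM : 0 ≤ M) (hT : 0 ≤ T) (C₁ : ℝ) : C₁ ≤ errorConst M T C₁ := by
  have := averagingConst_nonneg hM hM hT
  have := averagingLipschitzConst_nonneg hM hM hM hT
  rw [errorConst]
  linarith [Real.exp_pos (M * T)]

lemma averagingConst_le_errorConst (hM : 0 ≤ M) (hT : 0 ≤ T) (hC₁ : 0 ≤ C₁) :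
    averagingConst M M T ≤ errorConst M T C₁ := by
  have := averagingLipschitzConst_nonneg hM hM hM hT
  rw [errorConst]
  linarith [Real.exp_pos (M * T)]

lemma averagingLipschitzConst_le_errorConst (hM : 0 ≤ M) (hT : 0 ≤ T) (hC₁ : 0 ≤ C₁) :
    averagingLipschitzConst M M M T ≤ errorConst M T C₁ := by
  have := averagingConst_nonneg hM hM hT
  rw [errorConst]
  linarith [Real.exp_pos (M * T)]

end ErrorConst

namespace Data

variable {V : Type*} [NormedAddCommGroup V] [InnerProductSpace ℝ V]

lemma step_succ (d : Data V) (l : ℕ) : d.step (l + 1) = d.N * d.step l := by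
  rw [step, step, pow_succ', mul_assoc]

/-- The right-hand side of the multi-level error estimate on level `l` after `n` steps. -/
noncomputable def errorBound (d : Data V) (C : ℝ) (α₀ : ℕ → ℝ) (l n : ℕ) : ℝ :=
  (∑ j ∈ Finset.Icc 1 l, d.levelError C j (if j = l then n else d.N) *
    ∏ i ∈ Finset.Icc (j + 1) l, d.amp α₀ i) + d.delta0 C * ∏ i ∈ Finset.Icc 1 l, d.amp α₀ i

lemma errorBound_zero (d : Data V) (C : ℝ) (α₀ : ℕ → ℝ) (n : ℕ) :
    d.errorBound C α₀ 0 n = d.delta0 C := by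
  simp [errorBound]

lemma errorBound_succ (d : Data V) (C : ℝ) (α₀ : ℕ → ℝ) (l n : ℕ) :
    d.errorBound C α₀ (l + 1) n =
      d.levelError C (l + 1) n + d.errorBound C α₀ l d.N * d.amp α₀ (l + 1) := by
  have hlower : ∀ j ∈ Finset.Icc 1 l,
      d.levelError C j (if j = l + 1 then n else d.N) *
        ∏ i ∈ Finset.Icc (j + 1) (l + 1), d.amp α₀ i =
      d.levelError C j (if j = l then d.N else d.N) *
        (∏ i ∈ Finset.Icc (j + 1) l, d.amp α₀ i) * d.amp α₀ (l + 1) := fun j hj => by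
    have hjl := (Finset.mem_Icc.1 hj).2
    rw [if_neg (by omega), ite_self, Finset.prod_Icc_succ_top (by omega), mul_assoc]
  rw [errorBound, errorBound, Finset.sum_Icc_succ_top (by omega), Finset.sum_congr rfl hlower,
    ← Finset.sum_mul, if_pos rfl, Finset.Icc_eq_empty (by omega : ¬l + 1 + 1 ≤ l + 1),
    Finset.prod_empty, Finset.prod_Icc_succ_top (by omega : 1 ≤ l + 1)]
  ring

lemma runIn_succ (d : Data V) (l : ℕ) (t : ℝ) (x : V) :
    d.RunIn (l + 1) t x ↔ ∀ n < d.N, d.E t (n * d.step (l + 1)) x ∈ d.S ∧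
      (∀ j ≤ d.k (l + 1), d.U (l + 1) t x j n ∈ d.S) ∧
      ∀ j < d.k (l + 1), d.RunIn l (t + n * d.step (l + 1)) (d.U (l + 1) t x j n) :=
  Iff.rfl

lemma amp_eq_geometricMajorant (d : Data V) {C : ℝ} {α₀ : ℕ → ℝ} {l : ℕ}
    (hα₀ : d.N * (1 + α₀ l) ^ (d.N - 1) = ∑ i ∈ Finset.range d.N, (1 + d.alpha C l) ^ i) :
    d.amp α₀ l = geometricMajorant (d.alpha C l) (d.beta l) d.N := by
  rw [amp, geometricMajorant, ← hα₀]
  ring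

lemma E_zero (d : Data V) (t : ℝ) (x : V) : d.E t 0 x = x :=
  exactProp_zero _ _ _ _ _

namespace Assumptions

variable [CompleteSpace V] {d : Data V} {M C₁ C t r r' : ℝ} {l n : ℕ} {x y : V}

lemma step_pos (h : d.Assumptions M C₁) (l : ℕ) : 0 < d.step l :=
  mul_pos (pow_pos (Nat.cast_pos.2 h.N_pos) l) h.dt_pos

lemma T_nonneg (h : d.Assumptions M C₁) : 0 ≤ d.T :=
  h.grid ▸ (h.step_pos d.L).le

lemma eta_mul_eps_pos (h : d.Assumptions M C₁) (hl : 1 ≤ l) (hlL : l < d.L) : 0 < d.η l * d.ε :=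
  mul_pos (h.η_pos l hl hlL) h.ε_pos

lemma K_nonneg (h : d.Assumptions M C₁) (hl : 1 ≤ l) (hlL : l < d.L) : 0 ≤ d.K l := by
  refine Real.sSup_nonneg ?_
  rintro _ ⟨ω, hω, rfl⟩
  exact mul_nonneg (abs_nonneg _) (h.κ_nonneg l hl hlL ω hω)

lemma pow_step_mul_K_nonneg (h : d.Assumptions M C₁) (hl : 1 ≤ l) (hlL : l < d.L) :
    0 ≤ d.step l ^ (d.p + 1) * d.K l :=
  mul_nonneg (pow_nonneg (h.step_pos l).le _) (h.K_nonneg hl hlL)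

lemma isC1Field_modulationRHS (h : d.Assumptions M C₁) :
    IsC1Field (modulationRHS d.Lop d.Nl d.ε) d.D M M :=
  MLParareal.isC1Field_modulationRHS d.ε h.skew h.D_open h.D_convex h.D_invariant
    (h.Nl_smooth.of_le one_le_two) h.Nl_bound h.Nl_bound'

lemma norm_modulationRHS_sub_le (h : d.Assumptions M C₁) :
    ∀ s, ∀ x ∈ d.D, ∀ y ∈ d.D,
      ‖modulationRHS d.Lop d.Nl d.ε s x - modulationRHS d.Lop d.Nl d.ε s y‖ ≤ M * ‖x - y‖ :=
  fun s _ hx _ hy => h.isC1Field_modulationRHS.norm_sub_le s hx hy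

lemma isSolution_E (h : d.Assumptions M C₁) (ht : 0 ≤ t) (htT : t ≤ d.T) (hx : x ∈ d.S) :
    IsSolution (modulationRHS d.Lop d.Nl d.ε) d.D t d.T x fun s => d.E t (s - t) x :=
  isSolution_exactProp (h.solvable t ht htT x hx)

lemma isSolution_Ebar (h : d.Assumptions M C₁) (hl : 1 ≤ l) (hlL : l < d.L) (ht : 0 ≤ t)
    (htT : t ≤ d.T) (hx : x ∈ d.S) :
    IsSolution (shiftAverage (kernelMeasure d.ρ (d.η l * d.ε)) (modulationRHS d.Lop d.Nl d.ε))
      d.D t d.T x fun s => d.Ebar l t (s - t) x := by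
  rw [← averagedRHS_eq_shiftAverage d.Lop d.Nl h.ε_pos (h.η_pos l hl hlL) h.kernel]
  exact isSolution_exactProp (h.solvable_avg l hl hlL t ht htT x hx)

lemma exists_isSolution_E_apply (h : d.Assumptions M C₁) (ht : 0 ≤ t) (hx : x ∈ d.S)
    (hr : 0 ≤ r) (hrT : t + r ≤ d.T) :
    ∃ w, IsSolution (modulationRHS d.Lop d.Nl d.ε) d.D (t + r) d.T (d.E t r x) w := by
  have hE := (h.isSolution_E ht (by linarith) hx).restrict (t' := t + r) (by linarith)
  exact ⟨_, by simpa only [add_sub_cancel_left] using hE⟩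

lemma E_add (h : d.Assumptions M C₁) (ht : 0 ≤ t) (hx : x ∈ d.S) (hr : 0 ≤ r) (hr' : 0 ≤ r')
    (hT : t + r + r' ≤ d.T) : d.E t (r + r') x = d.E (t + r) r' (d.E t r x) :=
  exactProp_add h.norm_modulationRHS_sub_le (h.solvable t ht (by linarith) x hx) hr hr' hT

lemma E_succ_mul_step (h : d.Assumptions M C₁) (ht : 0 ≤ t) (hx : x ∈ d.S)
    (htT : t + n * d.step l + d.step l ≤ d.T) :
    d.E t ((n + 1 : ℕ) * d.step l) x =
      d.E (t + n * d.step l) (d.step l) (d.E t (n * d.step l) x) := by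
  have hs := h.step_pos l
  rw [Nat.cast_succ, add_one_mul]
  exact h.E_add ht hx (by positivity) hs.le htT

section AveragingError

lemma norm_M1_le_mul_averagingConst (h : d.Assumptions M C₁) (hM : 0 ≤ M) (hl : 1 ≤ l)
    (hlL : l < d.L) (ht : 0 ≤ t) (htT : t + d.step l ≤ d.T) (hx : x ∈ d.S) :
    ‖d.M1 l t x‖ ≤ d.η l * d.ε / 2 * averagingConst M M d.T := by
  have hs := h.step_pos l
  have ha := (h.eta_mul_eps_pos hl hlL).le
  have := h.kernel.isProbabilityMeasure (d.η l * d.ε)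
  have hE := h.isSolution_E ht (by linarith) hx
  have hEbar := h.isSolution_Ebar hl hlL ht (by linarith) hx
  have hle := h.isC1Field_modulationRHS.norm_sub_le_mul_averagingConst
    (ae_kernelMeasure_abs_le d.ρ ha) hE.isIntegralCurveOn hEbar.isIntegralCurveOn hE.mapsTo
    hEbar.mapsTo (hE.1.trans hEbar.1.symm) (s := t + d.step l) ⟨by linarith, htT⟩
  simp only [add_sub_cancel_left] at hle
  refine hle.trans (mul_le_mul_of_nonneg_left ?_ (by positivity))
  exact averagingConst_mono hM hM (by linarith)

lemma norm_M1_sub_le_mul_averagingLipschitzConst (h : d.Assumptions M C₁) (hM : 0 ≤ M)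
    (hl : 1 ≤ l) (hlL : l < d.L) (ht : 0 ≤ t) (htT : t + d.step l ≤ d.T) (hx : x ∈ d.S)
    (hy : y ∈ d.S) : ‖d.M1 l t x - d.M1 l t y‖ ≤
      d.η l * d.ε / 2 * averagingLipschitzConst M M M d.T * ‖x - y‖ := by
  have hs := h.step_pos l
  have htT' : t ≤ d.T := by linarith
  have := h.kernel.isProbabilityMeasure (d.η l * d.ε)
  have hEx := h.isSolution_E ht htT' hx
  have hEy := h.isSolution_E ht htT' hy
  have hEbarx := h.isSolution_Ebar hl hlL ht htT' hx
  have hEbary := h.isSolution_Ebar hl hlL ht htT' hy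
  have hfderiv := norm_fderiv_modulationRHS_sub_le d.ε h.skew h.D_open h.D_convex h.D_invariant
    h.Nl_smooth h.Nl_bound''
  have hle := h.isC1Field_modulationRHS.norm_sub_sub_sub_le_mul_averagingLipschitzConst hM
    (fun s x hx y hy => hfderiv s hx hy) (ae_kernelMeasure_abs_le d.ρ (h.eta_mul_eps_pos hl hlL).le)
    hEy.isIntegralCurveOn hEx.isIntegralCurveOn hEbary.isIntegralCurveOn hEbarx.isIntegralCurveOn
    hEy.mapsTo hEx.mapsTo hEbary.mapsTo hEbarx.mapsTo (hEy.1.trans hEbary.1.symm)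
    (hEx.1.trans hEbarx.1.symm) (T := d.T) (by linarith) (s := t + d.step l) ⟨by linarith, htT⟩
  simp only [add_sub_cancel_left, sub_self, E_zero] at hle
  exact hle

lemma norm_M1_le (h : d.Assumptions M C₁) (hM : 0 ≤ M) (hC₁ : 0 ≤ C₁)
    (hC : errorConst M d.T C₁ ≤ C) (hl : 1 ≤ l) (hlL : l < d.L) (ht : 0 ≤ t)
    (htT : t + d.step l ≤ d.T) (hx : x ∈ d.S) : ‖d.M1 l t x‖ ≤ C * d.η l * d.ε := by
  have ha := (h.eta_mul_eps_pos hl hlL).le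
  have hA := averagingConst_nonneg hM hM h.T_nonneg
  calc ‖d.M1 l t x‖ ≤ d.η l * d.ε / 2 * averagingConst M M d.T :=
        h.norm_M1_le_mul_averagingConst hM hl hlL ht htT hx
    _ ≤ d.η l * d.ε * C := by
        gcongr
        · exact half_le_self ha
        · exact (averagingConst_le_errorConst hM h.T_nonneg hC₁).trans hC
    _ = C * d.η l * d.ε := by ring

lemma norm_M1_sub_le (h : d.Assumptions M C₁) (hM : 0 ≤ M) (hC₁ : 0 ≤ C₁)
    (hC : errorConst M d.T C₁ ≤ C) (hl : 1 ≤ l) (hlL : l < d.L) (ht : 0 ≤ t)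
    (htT : t + d.step l ≤ d.T) (hx : x ∈ d.S) (hy : y ∈ d.S) :
    ‖d.M1 l t x - d.M1 l t y‖ ≤ C * d.η l * d.ε * ‖x - y‖ := by
  have ha := (h.eta_mul_eps_pos hl hlL).le
  have hA := averagingLipschitzConst_nonneg hM hM hM h.T_nonneg
  calc ‖d.M1 l t x - d.M1 l t y‖
      ≤ d.η l * d.ε / 2 * averagingLipschitzConst M M M d.T * ‖x - y‖ :=
        h.norm_M1_sub_le_mul_averagingLipschitzConst hM hl hlL ht htT hx hy
    _ ≤ d.η l * d.ε * C * ‖x - y‖ := by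
        gcongr
        · exact half_le_self ha
        · exact (averagingLipschitzConst_le_errorConst hM h.T_nonneg hC₁).trans hC
    _ = C * d.η l * d.ε * ‖x - y‖ := by ring

lemma normM1_nonneg (h : d.Assumptions M C₁) : 0 ≤ d.normM1 := by
  refine Real.sSup_nonneg ?_
  rintro _ ⟨l, t, x, hl, hlL, -, -, -, rfl⟩
  exact div_nonneg (norm_nonneg _) (h.eta_mul_eps_pos hl hlL).le

lemma norm_M1_le_normM1 (h : d.Assumptions M C₁) (hM : 0 ≤ M) (hC₁ : 0 ≤ C₁) (hl : 1 ≤ l)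
    (hlL : l < d.L) (ht : 0 ≤ t) (htT : t + d.step l ≤ d.T) (hx : x ∈ d.S) :
    ‖d.M1 l t x‖ ≤ d.η l * d.ε * d.normM1 := by
  rw [← div_le_iff₀' (h.eta_mul_eps_pos hl hlL)]
  refine le_csSup ⟨errorConst M d.T C₁, ?_⟩ ⟨l, t, x, hl, hlL, ht, htT, hx, rfl⟩
  rintro _ ⟨l, t, x, hl, hlL, ht, htT, hx, rfl⟩
  rw [div_le_iff₀ (h.eta_mul_eps_pos hl hlL), ← mul_assoc]
  exact h.norm_M1_le hM hC₁ le_rfl hl hlL ht htT hx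

end AveragingError

section TruncationError

lemma norm_M0_le (h : d.Assumptions M C₁) (hl : 1 ≤ l) (hlL : l < d.L) (ht : 0 ≤ t)
    (htT : t + d.step l ≤ d.T) (hx : x ∈ d.S) :
    ‖d.M0 l t x‖ ≤ C₁ * (d.step l ^ (d.p + 1) * d.K l) := by
  have hs := h.step_pos l
  calc ‖d.M0 l t x‖ ≤ d.Cbar l * d.step l ^ (d.p + 1) := (h.truncation l hl hlL).1 t ht htT x hx
    _ ≤ C₁ * d.K l * d.step l ^ (d.p + 1) := by
      gcongr
      exact h.Cbar_le l hl hlL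
    _ = C₁ * (d.step l ^ (d.p + 1) * d.K l) := by ring

lemma norm_M0_sub_le (h : d.Assumptions M C₁) (hl : 1 ≤ l) (hlL : l < d.L) (ht : 0 ≤ t)
    (htT : t + d.step l ≤ d.T) (hx : x ∈ d.S) (hy : y ∈ d.S) :
    ‖d.M0 l t x - d.M0 l t y‖ ≤ C₁ * (d.step l ^ (d.p + 1) * d.K l) * ‖x - y‖ := by
  have hs := h.step_pos l
  obtain ⟨-, coef, lam, hsum, hlam, hcoef⟩ := h.truncation l hl hlL
  obtain ⟨hlip, hexpansion⟩ := hcoef t ht htT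
  have hB : HasSum (fun j => d.step l ^ (d.p + 1 + j) * lam j)
      (d.step l ^ (d.p + 1) * ∑' j, lam j * d.step l ^ j) := by
    simpa only [pow_add, mul_assoc, mul_comm (lam _)] using
      hsum.hasSum.mul_left (d.step l ^ (d.p + 1))
  calc ‖d.M0 l t x - d.M0 l t y‖
      ≤ d.step l ^ (d.p + 1) * (∑' j, lam j * d.step l ^ j) * ‖x - y‖ :=
        norm_sub_le_of_hasSum_smul (fun j => by positivity) (hexpansion x hx) (hexpansion y hy) hB
          fun j => hlip j x hx y hy
    _ ≤ d.step l ^ (d.p + 1) * (C₁ * d.K l) * ‖x - y‖ := by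
        gcongr
        exact hlam.trans (h.Cbar_le l hl hlL)
    _ = C₁ * (d.step l ^ (d.p + 1) * d.K l) * ‖x - y‖ := by ring

lemma normM0_nonneg (h : d.Assumptions M C₁) : 0 ≤ d.normM0 := by
  refine Real.sSup_nonneg ?_
  rintro _ ⟨l, t, x, hl, hlL, -, -, -, rfl⟩
  exact div_nonneg (norm_nonneg _) (h.pow_step_mul_K_nonneg hl hlL)

lemma norm_M0_le_normM0 (h : d.Assumptions M C₁) (hC₁ : 0 ≤ C₁) (hl : 1 ≤ l) (hlL : l < d.L)
    (ht : 0 ≤ t) (htT : t + d.step l ≤ d.T) (hx : x ∈ d.S) :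
    ‖d.M0 l t x‖ ≤ d.step l ^ (d.p + 1) * d.K l * d.normM0 := by
  rcases (h.pow_step_mul_K_nonneg hl hlL).eq_or_lt with hzero | hpos
  · have hM0 := h.norm_M0_le hl hlL ht htT hx
    rw [← hzero] at hM0 ⊢
    simpa using hM0
  · rw [← div_le_iff₀' hpos]
    refine le_csSup ⟨C₁, ?_⟩ ⟨l, t, x, hl, hlL, ht, htT, hx, rfl⟩
    rintro _ ⟨l, t, x, hl, hlL, ht, htT, hx, rfl⟩
    exact div_le_of_le_mul₀ (h.pow_step_mul_K_nonneg hl hlL) hC₁ (h.norm_M0_le hl hlL ht htT hx)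

end TruncationError

section LevelConstants

lemma alpha_nonneg (h : d.Assumptions M C₁) (hC : 0 ≤ C) (hl : 1 ≤ l) (hlL : l < d.L) :
    0 ≤ d.alpha C l := by
  simp only [alpha, mul_assoc]
  exact add_nonneg (mul_nonneg hC (h.eta_mul_eps_pos hl hlL).le)
    (mul_nonneg hC (h.pow_step_mul_K_nonneg hl hlL))

lemma gamma_nonneg (h : d.Assumptions M C₁) (hC : 0 ≤ C) (hl : 1 ≤ l) (hlL : l < d.L) :
    0 ≤ d.gamma C l := by
  rw [gamma, mul_assoc C, mul_assoc C (_ ^ _)]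
  exact add_nonneg (mul_nonneg (mul_nonneg hC (h.eta_mul_eps_pos hl hlL).le) h.normM1_nonneg)
    (mul_nonneg (mul_nonneg hC (h.pow_step_mul_K_nonneg hl hlL)) h.normM0_nonneg)

lemma one_le_beta (h : d.Assumptions M C₁) (hl : 1 ≤ l) (hlL : l < d.L) : 1 ≤ d.beta l :=
  le_add_of_nonneg_right (mul_nonneg (h.C₂_nonneg l hl hlL) (h.step_pos l).le)

lemma delta0_nonneg (h : d.Assumptions M C₁) (hC : 0 ≤ C) : 0 ≤ d.delta0 C :=
  mul_nonneg (mul_nonneg (mul_nonneg hC h.c_nonneg) (h.step_pos 1).le)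
    (pow_nonneg (h.step_pos 0).le _)

lemma levelError_nonneg (h : d.Assumptions M C₁) (hC : 0 ≤ C) (hl : 1 ≤ l) (hlL : l < d.L)
    (n : ℕ) : 0 ≤ d.levelError C l n := by
  have hγ := h.gamma_nonneg hC hl hlL
  have hα := h.alpha_nonneg hC hl hlL
  have hβ := zero_le_one.trans (h.one_le_beta hl hlL)
  rw [levelError]
  positivity

lemma gamma_mul_binomialMajorant_le_levelError (h : d.Assumptions M C₁) (hC : 0 ≤ C)
    (hl : 1 ≤ l) (hlL : l < d.L) (hn : n ≤ d.N) :
    d.gamma C l * binomialMajorant (d.alpha C l) (d.beta l) (d.k l) n ≤ d.levelError C l n := by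
  have hγ := h.gamma_nonneg hC hl hlL
  have hα := h.alpha_nonneg hC hl hlL
  have hβ := h.one_le_beta hl hlL
  calc d.gamma C l * binomialMajorant (d.alpha C l) (d.beta l) (d.k l) n
      = n.choose (d.k l + 1) * d.gamma C l * d.alpha C l ^ d.k l *
          d.beta l ^ (n - d.k l - 1) := by
        rw [binomialMajorant]
        ring
    _ ≤ d.levelError C l n := by
        rw [levelError]
        gcongr

lemma norm_E_sub_G_le (h : d.Assumptions M C₁) (hM : 0 ≤ M) (hC₁ : 0 ≤ C₁) (hC : 1 ≤ C)
    (hl : 1 ≤ l) (hlL : l < d.L) (ht : 0 ≤ t) (htT : t + d.step l ≤ d.T) (hx : x ∈ d.S) :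
    ‖d.E t (d.step l) x - d.G l t x‖ ≤ d.gamma C l := by
  have hM1 := h.norm_M1_le_normM1 hM hC₁ hl hlL ht htT hx
  have hM0 := h.norm_M0_le_normM0 hC₁ hl hlL ht htT hx
  calc ‖d.E t (d.step l) x - d.G l t x‖ ≤ ‖d.M1 l t x‖ + ‖d.M0 l t x‖ :=
        norm_sub_le_norm_sub_add_norm_sub _ _ _
    _ ≤ C * (d.η l * d.ε * d.normM1) + C * (d.step l ^ (d.p + 1) * d.K l * d.normM0) :=
        add_le_add (hM1.trans (le_mul_of_one_le_left ((norm_nonneg _).trans hM1) hC))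
          (hM0.trans (le_mul_of_one_le_left ((norm_nonneg _).trans hM0) hC))
    _ = d.gamma C l := by rw [gamma]; ring

lemma norm_E_sub_G_sub_le (h : d.Assumptions M C₁) (hM : 0 ≤ M) (hC₁ : 0 ≤ C₁)
    (hC : errorConst M d.T C₁ ≤ C) (hl : 1 ≤ l) (hlL : l < d.L) (ht : 0 ≤ t)
    (htT : t + d.step l ≤ d.T) (hx : x ∈ d.S) (hy : y ∈ d.S) :
    ‖(d.E t (d.step l) x - d.G l t x) - (d.E t (d.step l) y - d.G l t y)‖ ≤
      d.alpha C l * ‖x - y‖ := by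
  have hK := h.pow_step_mul_K_nonneg hl hlL
  have hsplit : (d.E t (d.step l) x - d.G l t x) - (d.E t (d.step l) y - d.G l t y) =
      (d.M1 l t x - d.M1 l t y) + (d.M0 l t x - d.M0 l t y) := by
    rw [M1, M1, M0, M0]
    abel
  have hM0 : ‖d.M0 l t x - d.M0 l t y‖ ≤ C * (d.step l ^ (d.p + 1) * d.K l) * ‖x - y‖ := by
    refine (h.norm_M0_sub_le hl hlL ht htT hx hy).trans ?_
    gcongr
    exact (le_errorConst hM h.T_nonneg C₁).trans hC
  calc ‖(d.E t (d.step l) x - d.G l t x) - (d.E t (d.step l) y - d.G l t y)‖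
      ≤ ‖d.M1 l t x - d.M1 l t y‖ + ‖d.M0 l t x - d.M0 l t y‖ := hsplit ▸ norm_add_le _ _
    _ ≤ C * d.η l * d.ε * ‖x - y‖ + C * (d.step l ^ (d.p + 1) * d.K l) * ‖x - y‖ :=
        add_le_add (h.norm_M1_sub_le hM hC₁ hC hl hlL ht htT hx hy) hM0
    _ = d.alpha C l * ‖x - y‖ := by rw [alpha]; ring

end LevelConstants

section LevelRecursion

variable {α₀ : ℕ → ℝ} {δ : ℝ}

lemma norm_E_sub_P_zero_le (h : d.Assumptions M C₁) (hM : 0 ≤ M) (hC : Real.exp (M * d.T) ≤ C)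
    (ht : 0 ≤ t) (htT : t + d.step 1 ≤ d.T) (hrun : d.RunIn 0 t x) :
    ‖d.E t (d.step 1) x - d.P 0 t x‖ ≤ d.delta0 C := by
  have hs := h.step_pos 0
  have hc := h.c_nonneg
  have hx : x ∈ d.S := hrun 0 h.N_pos
  have htime : ∀ n < d.N, 0 ≤ t + n * d.step 0 ∧ t + n * d.step 0 + d.step 0 ≤ d.T :=
    fun n hn => gridPoint_bounds hn ht hs.le (d.step_succ 0 ▸ htT)
  have hserial := norm_sub_serialSteps_le (g := d.G 0) (q := Real.exp (M * d.step 0))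
    (δ := d.c * d.step 0 ^ (d.p₀ + 1)) (Φ := fun s u => d.E s (d.step 0) u)
    (y := fun n => d.E t (n * d.step 0) x) (Real.one_le_exp (by positivity)) (by positivity)
    (by simp [E_zero]) (fun n hn => h.E_succ_mul_step ht hx (htime n hn).2)
    (fun n hn => norm_exactProp_sub_le h.norm_modulationRHS_sub_le
      (h.exists_isSolution_E_apply ht hx (by positivity) (by linarith [(htime n hn).2]))
      (h.solvable _ (htime n hn).1 (by linarith [(htime n hn).2]) _ (hrun n hn)) hs.le
      (htime n hn).2)
    (fun n hn => h.fine _ (htime n hn).1 (htime n hn).2 _ (hrun n hn)) d.N le_rfl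
  have hexp : Real.exp (M * d.step 0) ^ d.N ≤ C := by
    rw [← Real.exp_nat_mul, mul_left_comm, ← d.step_succ 0]
    refine le_trans (Real.exp_le_exp.2 ?_) hC
    gcongr
    linarith
  calc ‖d.E t (d.step 1) x - d.P 0 t x‖
      ≤ d.N * (d.c * d.step 0 ^ (d.p₀ + 1)) * Real.exp (M * d.step 0) ^ d.N := by
        rw [d.step_succ 0]
        exact hserial
    _ ≤ d.N * (d.c * d.step 0 ^ (d.p₀ + 1)) * C := by gcongr
    _ = d.delta0 C := by rw [delta0, d.step_succ 0]; ring

lemma norm_E_sub_U_le (h : d.Assumptions M C₁) (hM : 0 ≤ M) (hC₁ : 0 ≤ C₁)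
    (hC : errorConst M d.T C₁ ≤ C) (hlL : l + 1 < d.L) (hδ : 0 ≤ δ)
    (hP : ∀ t x, 0 ≤ t → t + d.step (l + 1) ≤ d.T → d.RunIn l t x →
      ‖d.E t (d.step (l + 1)) x - d.P l t x‖ ≤ δ)
    (ht : 0 ≤ t) (htT : t + d.N * d.step (l + 1) ≤ d.T) (hrun : d.RunIn (l + 1) t x)
    (hn : n ≤ d.N) :
    ‖d.E t (n * d.step (l + 1)) x - d.U (l + 1) t x (d.k (l + 1)) n‖ ≤ d.levelError C (l + 1) n +
      δ * geometricMajorant (d.alpha C (l + 1)) (d.beta (l + 1)) d.N := by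
  have hl : 1 ≤ l + 1 := Nat.le_add_left 1 l
  have hC' : 1 ≤ C := (one_le_errorConst hM h.T_nonneg hC₁).trans hC
  have hC₀ : 0 ≤ C := zero_le_one.trans hC'
  have hα := h.alpha_nonneg hC₀ hl hlL
  have hβ := h.one_le_beta hl hlL
  have hx : x ∈ d.S := by simpa [E_zero] using (hrun 0 h.N_pos).1
  have htime : ∀ n < d.N, 0 ≤ t + n * d.step (l + 1) ∧
      t + n * d.step (l + 1) + d.step (l + 1) ≤ d.T := fun n hn =>
    gridPoint_bounds hn ht (h.step_pos _).le htT
  rw [runIn_succ] at hrun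
  have hiterate := norm_sub_iterate_le (Φ := fun s u => d.E s (d.step (l + 1)) u)
    (y := fun n => d.E t (n * d.step (l + 1)) x) hα hβ (h.gamma_nonneg hC₀ hl hlL) hδ
    (by simp [E_zero]) (fun n hn => h.E_succ_mul_step ht hx (htime n hn).2)
    (fun n hn => (hrun n hn).1) (fun n hn => (hrun n hn).2.1)
    (fun n hn u hu => h.norm_E_sub_G_le hM hC₁ hC' hl hlL (htime n hn).1 (htime n hn).2 hu)
    (fun n hn u hu v hv =>
      h.norm_E_sub_G_sub_le hM hC₁ hC hl hlL (htime n hn).1 (htime n hn).2 hu hv)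
    (fun n hn => h.stability (l + 1) hl hlL _ (htime n hn).1 (htime n hn).2)
    (fun n hn j hj => hP _ _ (htime n hn).1 (htime n hn).2 ((hrun n hn).2.2 j hj))
  exact (hiterate n hn (d.k (l + 1)) le_rfl).trans (add_le_add
    (h.gamma_mul_binomialMajorant_le_levelError hC₀ hl hlL hn)
    (mul_le_mul_of_nonneg_left (geometricMajorant_monotone hα hβ hn) hδ))

lemma errorBound_nonneg (h : d.Assumptions M C₁) (hC : 0 ≤ C)
    (hamp : ∀ l, 1 ≤ l → l < d.L →
      d.amp α₀ l = geometricMajorant (d.alpha C l) (d.beta l) d.N)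
    (hlL : l < d.L) (n : ℕ) :
    0 ≤ d.errorBound C α₀ l n := by
  induction l generalizing n with
  | zero => exact (d.errorBound_zero C α₀ n).symm ▸ h.delta0_nonneg hC
  | succ l ih =>
    rw [errorBound_succ]
    exact add_nonneg (h.levelError_nonneg hC (by omega) hlL n)
      (mul_nonneg (ih (by omega) d.N) (hamp (l + 1) (by omega) hlL ▸ geometricMajorant_nonneg
        (h.alpha_nonneg hC (by omega) hlL)
        (zero_le_one.trans (h.one_le_beta (by omega) hlL)) d.N))

lemma norm_E_sub_P_le_errorBound (h : d.Assumptions M C₁) (hM : 0 ≤ M) (hC₁ : 0 ≤ C₁)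
    (hC : errorConst M d.T C₁ ≤ C)
    (hamp : ∀ l, 1 ≤ l → l < d.L →
      d.amp α₀ l = geometricMajorant (d.alpha C l) (d.beta l) d.N)
    (hlL : l < d.L) (ht : 0 ≤ t) (htT : t + d.step (l + 1) ≤ d.T) (hrun : d.RunIn l t x) :
    ‖d.E t (d.step (l + 1)) x - d.P l t x‖ ≤ d.errorBound C α₀ l d.N := by
  have hC₀ : 0 ≤ C := zero_le_one.trans ((one_le_errorConst hM h.T_nonneg hC₁).trans hC)
  induction l generalizing t x with
  | zero =>
    rw [errorBound_zero]
    exact h.norm_E_sub_P_zero_le hM ((exp_le_errorConst hM h.T_nonneg hC₁).trans hC) ht htT hrun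
  | succ l ih =>
    rw [step_succ] at htT ⊢
    rw [errorBound_succ, hamp (l + 1) (by omega) hlL]
    exact h.norm_E_sub_U_le hM hC₁ hC hlL (h.errorBound_nonneg hC₀ hamp (by omega) d.N)
      (fun t x => ih (by omega)) ht htT hrun le_rfl

lemma norm_E_sub_U_le_errorBound (h : d.Assumptions M C₁) (hM : 0 ≤ M) (hC₁ : 0 ≤ C₁)
    (hC : errorConst M d.T C₁ ≤ C)
    (hamp : ∀ l, 1 ≤ l → l < d.L →
      d.amp α₀ l = geometricMajorant (d.alpha C l) (d.beta l) d.N)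
    (hl : 1 ≤ l) (hlL : l < d.L) (ht : 0 ≤ t) (htT : t + d.N * d.step l ≤ d.T)
    (hrun : d.RunIn l t x) (hn : n ≤ d.N) :
    ‖d.E t (n * d.step l) x - d.U l t x (d.k l) n‖ ≤ d.errorBound C α₀ l n := by
  obtain ⟨l, rfl⟩ := Nat.exists_eq_add_of_le' hl
  have hC₀ : 0 ≤ C := zero_le_one.trans ((one_le_errorConst hM h.T_nonneg hC₁).trans hC)
  rw [errorBound_succ, hamp (l + 1) hl hlL]
  exact h.norm_E_sub_U_le hM hC₁ hC hlL (h.errorBound_nonneg hC₀ hamp (by omega) d.N)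
    (fun t x ht htT hrun => h.norm_E_sub_P_le_errorBound hM hC₁ hC hamp (by omega) ht htT hrun)
    ht htT hrun hn

end LevelRecursion

end Assumptions

end Data

end MLParareal

theorem mainTheorem4 {V : Type*} [NormedAddCommGroup V] [InnerProductSpace ℝ V] [CompleteSpace V]
    (M T C₁ : ℝ) (hM : 0 ≤ M) (hT : 0 < T) (hC₁ : 0 ≤ C₁) :
    ∃ C : ℝ, 0 < C ∧ ∀ d : MLParareal.Data V, d.T = T → d.Assumptions M C₁ →
      (∀ l, 1 ≤ l → l < d.L → ∀ t, 0 ≤ t → t + d.step l ≤ T → ∀ x ∈ d.S, ∀ y ∈ d.S,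
        ‖d.M1 l t x‖ ≤ C * d.η l * d.ε ∧
        ‖d.M1 l t x - d.M1 l t y‖ ≤ C * d.η l * d.ε * ‖x - y‖) ∧
      ∃ α₀ : ℕ → ℝ,
        (∀ l, 1 ≤ l → l < d.L → α₀ l ∈ Set.Icc 0 (d.alpha C l) ∧
          (1 + d.alpha C l) ^ d.N - 1 = d.N * d.alpha C l * (1 + α₀ l) ^ (d.N - 1)) ∧
        ∀ l, 1 ≤ l → l < d.L → ∀ t x, 0 ≤ t → t + d.N * d.step l ≤ T → d.RunIn l t x →
          ∀ n ≤ d.N,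
            ‖d.E t (n * d.step l) x - d.U l t x (d.k l) n‖ ≤
              (∑ j ∈ Finset.Icc 1 l,
                  d.levelError C j (if j = l then n else d.N)
                    * ∏ i ∈ Finset.Icc (j + 1) l, d.amp α₀ i)
                + d.delta0 C * ∏ i ∈ Finset.Icc 1 l, d.amp α₀ i := by
  have hC₀ : 0 < MLParareal.errorConst M T C₁ :=
    zero_lt_one.trans_le (MLParareal.one_le_errorConst hM hT.le hC₁)
  refine ⟨MLParareal.errorConst M T C₁, hC₀, ?_⟩
  rintro d rfl h
  choose! α₀ hα₀_mem hα₀ using fun l (hl : 1 ≤ l) (hlL : l < d.L) =>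
    MLParareal.exists_mul_pow_eq_geom_sum (h.alpha_nonneg hC₀.le hl hlL) d.N
  refine ⟨fun l hl hlL t ht htT x hx y hy => ⟨h.norm_M1_le hM hC₁ le_rfl hl hlL ht htT hx,
    h.norm_M1_sub_le hM hC₁ le_rfl hl hlL ht htT hx hy⟩, α₀, fun l hl hlL => ⟨hα₀_mem l hl hlL,
      MLParareal.pow_sub_one_eq_of_mul_pow_eq_geom_sum (hα₀ l hl hlL)⟩, ?_⟩
  have hamp := fun l hl hlL => d.amp_eq_geometricMajorant (hα₀ l hl hlL)
  exact fun l hl hlL t x ht htT hrun n hn =>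
    h.norm_E_sub_U_le_errorBound hM hC₁ le_rfl hamp hl hlL ht htT hrun hn
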